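/- **Setting.** Let $(\Omega,\mathcal F,(\mathcal F_t)_{t\ge 0},\mathbb P)$ be a filtered probability space whose filtration is right-continuous and such that $\mathcal F_0$ contains all negligible sets. Let $T>0$, $d\ge 1$, let $D\subset\mathbb R^d$ be a bounded open set, $2\le p<\infty$, and let $V=W^{1,p}(D)$ with $\|v\|_V^p=\int_D(|\nabla v|^p+|v|^p)\,dx$. For $u,w\in V$ put $$\langle \Delta_p^N u,w\rangle_{V^*,V}=\int_D |\nabla u|^{p-2}\nabla u\cdot\nabla w+|u|^{p-2}uw\,dx,$$ and for $\varepsilon>0$ let $\psi_\varepsilon(v)=-\frac{v^-}{\varepsilon}+\frac{(v-1)^+}{\varepsilon}$, $v\in\mathbb R$. Let $U$ be a separable Hilbert space with a continuous inclusion $L^2(D)\subset U$, $Q:U\to U$ a non-negative symmetric trace class operator with $Q^{1/2}(U)=L^2(D)$, and $(e_j)_{j\in\mathbb N}$ an orthonormal basis of $U$ of eigenvectors of $Q$ with eigenvalues $\lambda_j\ge 0$. Assume: * $(H_1)$ $u_0\in L^2(\Omega;L^2(D))$ is $\mathcal F_0$-measurable and $0\le u_0\le 1$ a.e. in $\Omega\times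 D$. * $(H_2)$ $G$ maps $L^2(D)$ into the Hilbert–Schmidt operators on $L^2(D)$, with $G(v)(Q^{1/2}e_j)=g_j(v)$ for all $v\in L^2(D)$ and all $j$, where the functions $g_j:\mathbb R\to\mathbb R$ are continuous, $\operatorname{supp} g_j\subset(0,1)$, and for some $L_g\ge 0$, $\sum_j|g_j(r)-g_j(s)|^2\le L_g|r-s|^2$ for all $r,s\in\mathbb R$. * $(H_3)$ $\beta:\mathbb R\to\mathbb R$ is Lipschitz continuous with constant $L_\beta>0$, and $\beta(0)=0$. * $(H_4)$ $f:\Omega\times(0,T)\to L^2(D)$ is predictable and square integrable on $\Omega\times(0,T)$. * $(H_5)$ $(W_j)_j$ is a sequence of independent real-valued Wiener processes with respect to $(\mathcal F_t)_{t\ge 0}$, and $\mathcal W(t)=\sum_j Q^{1/2}(e_j)W_j(t)$ in $L^2(\Omega;U)$ for all $t\ge 0$. **Proposition.** Let $\varepsilon>0$, let $M\ge 1$ be an integer, $\tau=T/M$, $t_n=n\tau$, and assume $\tau<1/L_\beta$. Let $n\in\{0,\dots,M-1\}$ and let $u_{\varepsilon,n}$ be any $\mathcal F_{t_n}$-measurable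 random variable with values in $L^2(D)$. Put $f_n=\frac1\tau\int_{t_n}^{t_{n+1}}f(s)\,ds$ and $$G(u_{\varepsilon,n})\Delta_{n+1}\mathcal W:=\sum_j G(u_{\varepsilon,n})(Q^{1/2}e_j)\,\bigl(W_j(t_{n+1})-W_j(t_n)\bigr).$$ Then this series converges in $L^2(\Omega;L^2(D))$, and there exists an $\mathcal F_{t_{n+1}}$-measurable random variable $u_{\varepsilon,n+1}$ with values in $V$, unique up to $\mathbb P$-almost sure equality, such that $\mathbb P$-a.s. $\Delta_p^N u_{\varepsilon,n+1}\in V^*$ is represented by an element of $L^2(D)$ and $$u_{\varepsilon,n+1}-u_{\varepsilon,n}+\tau\bigl(\Delta_p^N u_{\varepsilon,n+1}+\psi_\varepsilon(u_{\varepsilon,n+1})\bigr)=G(u_{\varepsilon,n})\Delta_{n+1}\mathcal W+\tau\bigl(\beta(u_{\varepsilon,n+1})+f_n\bigr)\quad\text{in }L^2(D).$$ -/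

import Mathlib

open MeasureTheory ProbabilityTheory Filter Topology
open scoped NNReal ENNReal InnerProductSpace

noncomputable section

/-- The Euclidean space `ℝ^d`. -/
abbrev Euc (d : ℕ) : Type := EuclideanSpace ℝ (Fin d)

/-- The Hilbert space `L²(D)`. -/
abbrev L2 {d : ℕ} (D : Set (Euc d)) : Type := Lp ℝ 2 (volume.restrict D)

/-- `g` is the weak gradient of `u` on `D`: for every test function `φ ∈ C_c^∞(D)` and every
direction `v`, `∫_D u ∂_v φ = - ∫_D (g · v) φ`. -/
def IsWeakGradient {d : ℕ} (D : Set (Euc d)) (u : Euc d → ℝ) (g : Euc d → Euc d) : Prop :=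
  ∀ φ : Euc d → ℝ, ContDiff ℝ ((⊤ : ℕ∞) : WithTop ℕ∞) φ → HasCompactSupport φ →
    tsupport φ ⊆ D → ∀ v : Euc d,
      ∫ x in D, u x * fderiv ℝ φ x v = -∫ x in D, ⟪g x, v⟫_ℝ * φ x

lemma integrable_mul_of_test {d : ℕ} {D : Set (Euc d)} {p : ℝ≥0∞} [Fact (1 ≤ p)]
    {u : Euc d → ℝ} (hu : MemLp u p (volume.restrict D)) {ψ : Euc d → ℝ}
    (hψ : Continuous ψ) (hc : HasCompactSupport ψ) :
    Integrable (fun x => u x * ψ x) (volume.restrict D) := by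
  have h := (hu.locallyIntegrable Fact.out).integrable_smul_left_of_hasCompactSupport hψ hc
  simpa only [smul_eq_mul, mul_comm] using h

lemma IsWeakGradient.integrable_left {d : ℕ} {D : Set (Euc d)} {p : ℝ≥0∞} [Fact (1 ≤ p)]
    {u : Euc d → ℝ} (hu : MemLp u p (volume.restrict D)) {φ : Euc d → ℝ}
    (hφ : ContDiff ℝ ((⊤ : ℕ∞) : WithTop ℕ∞) φ) (hc : HasCompactSupport φ) (v : Euc d) :
    Integrable (fun x => u x * fderiv ℝ φ x v) (volume.restrict D) := by
  refine integrable_mul_of_test hu ?_ (hc.fderiv_apply ℝ v)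
  exact (hφ.continuous_fderiv (by simp)).clm_apply continuous_const

lemma IsWeakGradient.integrable_right {d : ℕ} {D : Set (Euc d)} {p : ℝ≥0∞} [Fact (1 ≤ p)]
    {g : Euc d → Euc d} (hg : MemLp g p (volume.restrict D)) {φ : Euc d → ℝ}
    (hφ : ContDiff ℝ ((⊤ : ℕ∞) : WithTop ℕ∞) φ) (hc : HasCompactSupport φ) (v : Euc d) :
    Integrable (fun x => ⟪g x, v⟫_ℝ * φ x) (volume.restrict D) :=
  integrable_mul_of_test (hg.inner_const v) hφ.continuous hc

/-- The Sobolev space `V = W^{1,p}(D)`. An element is a function `u ∈ L^p(D)` together with its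
(unique) weak gradient `∇u ∈ L^p(D)^d`; the norm inherited from the `ℓ^p`-product is
`‖u‖_V = (∫_D |u|^p + |∇u|^p)^{1/p}`. -/
def W1p {d : ℕ} (D : Set (Euc d)) (p : ℝ≥0∞) [Fact (1 ≤ p)] :
    Submodule ℝ (WithLp p (Lp ℝ p (volume.restrict D) × Lp (Euc d) p (volume.restrict D))) where
  carrier := {z | IsWeakGradient D z.fst z.snd}
  zero_mem' := by
    intro φ _ _ _ v
    have h1 : ∫ x in D, ((0 : Lp ℝ p (volume.restrict D)) : Euc d → ℝ) x * fderiv ℝ φ x v = 0 := by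
      refine integral_eq_zero_of_ae ?_
      filter_upwards [Lp.coeFn_zero ℝ p (volume.restrict D)] with x hx
      rw [hx]; simp
    have h2 : ∫ x in D, ⟪((0 : Lp (Euc d) p (volume.restrict D)) : Euc d → Euc d) x, v⟫_ℝ * φ x
        = 0 := by
      refine integral_eq_zero_of_ae ?_
      filter_upwards [Lp.coeFn_zero (Euc d) p (volume.restrict D)] with x hx
      rw [hx]; simp
    rw [WithLp.zero_fst, WithLp.zero_snd, h1, h2, neg_zero]
  add_mem' := by
    intro a b ha hb φ hφ hc hs v
    rw [WithLp.add_fst, WithLp.add_snd]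
    have h1 : ∫ x in D, (a.fst + b.fst) x * fderiv ℝ φ x v
        = ∫ x in D, (a.fst x * fderiv ℝ φ x v + b.fst x * fderiv ℝ φ x v) := by
      refine integral_congr_ae ?_
      filter_upwards [Lp.coeFn_add a.fst b.fst] with x hx
      rw [hx, Pi.add_apply, add_mul]
    have h2 : ∫ x in D, ⟪(a.snd + b.snd) x, v⟫_ℝ * φ x
        = ∫ x in D, (⟪a.snd x, v⟫_ℝ * φ x + ⟪b.snd x, v⟫_ℝ * φ x) := by
      refine integral_congr_ae ?_
      filter_upwards [Lp.coeFn_add a.snd b.snd] with x hx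
      rw [hx, Pi.add_apply, inner_add_left, add_mul]
    rw [h1, h2,
      integral_add (IsWeakGradient.integrable_left (Lp.memLp a.fst) hφ hc v)
        (IsWeakGradient.integrable_left (Lp.memLp b.fst) hφ hc v),
      integral_add (IsWeakGradient.integrable_right (Lp.memLp a.snd) hφ hc v)
        (IsWeakGradient.integrable_right (Lp.memLp b.snd) hφ hc v),
      ha φ hφ hc hs v, hb φ hφ hc hs v, neg_add]
  smul_mem' := by
    intro c a ha φ hφ hc hs v
    rw [WithLp.smul_fst, WithLp.smul_snd]
    have h1 : ∫ x in D, (c • a.fst) x * fderiv ℝ φ x v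
        = ∫ x in D, c * (a.fst x * fderiv ℝ φ x v) := by
      refine integral_congr_ae ?_
      filter_upwards [Lp.coeFn_smul c a.fst] with x hx
      rw [hx, Pi.smul_apply, smul_eq_mul, mul_assoc]
    have h2 : ∫ x in D, ⟪(c • a.snd) x, v⟫_ℝ * φ x
        = ∫ x in D, c * (⟪a.snd x, v⟫_ℝ * φ x) := by
      refine integral_congr_ae ?_
      filter_upwards [Lp.coeFn_smul c a.snd] with x hx
      rw [hx, Pi.smul_apply, real_inner_smul_left, mul_assoc]
    rw [h1, h2, integral_const_mul, integral_const_mul, ha φ hφ hc hs v, mul_neg]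

/-- The function `u ∈ L^p(D)` underlying an element of `W^{1,p}(D)`. -/
def W1p.toFn {d : ℕ} {D : Set (Euc d)} {p : ℝ≥0∞} [Fact (1 ≤ p)] (u : W1p D p) : Euc d → ℝ :=
  u.1.fst

/-- The weak gradient `∇u` of an element of `W^{1,p}(D)`. -/
def W1p.weakGrad {d : ℕ} {D : Set (Euc d)} {p : ℝ≥0∞} [Fact (1 ≤ p)] (u : W1p D p) :
    Euc d → Euc d :=
  u.1.snd

/-- The Neumann `p`-Laplace operator `Δ_p^N : V → V*`,
`⟨Δ_p^N u, w⟩ = ∫_D |∇u|^{p-2} ∇u · ∇w + |u|^{p-2} u w dx`. -/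
def pLaplaceN {d : ℕ} {D : Set (Euc d)} {p : ℝ≥0∞} [Fact (1 ≤ p)] (u w : W1p D p) : ℝ :=
  ∫ x in D, (‖W1p.weakGrad u x‖ ^ (p.toReal - 2) * ⟪W1p.weakGrad u x, W1p.weakGrad w x⟫_ℝ
    + |W1p.toFn u x| ^ (p.toReal - 2) * W1p.toFn u x * W1p.toFn w x)

/-- The functional `Δ_p^N u ∈ V*` is (represented by) the element `h` of `L²(D)`. -/
def IsPLaplaceN {d : ℕ} {D : Set (Euc d)} {p : ℝ≥0∞} [Fact (1 ≤ p)] (u : W1p D p)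
    (h : L2 D) : Prop :=
  ∀ w : W1p D p, pLaplaceN u w = ∫ x in D, h x * W1p.toFn w x

/-- The Moreau–Yosida approximation `ψ_ε(v) = -v⁻/ε + (v-1)⁺/ε`. -/
def psiMY (ε v : ℝ) : ℝ := -(max (-v) 0) / ε + max (v - 1) 0 / ε

/-- `A` is a Hilbert–Schmidt operator: `∑ ‖A b_i‖² < ∞` for some orthonormal (Hilbert) basis
(equivalently, for each of them). -/
def IsHilbertSchmidt {H K : Type*} [NormedAddCommGroup H] [InnerProductSpace ℝ H]
    [NormedAddCommGroup K] [InnerProductSpace ℝ K] (A : H →L[ℝ] K) : Prop :=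
  ∃ (s : Set H) (b : HilbertBasis s ℝ H), Summable fun i => ‖A (b i)‖ ^ 2

/-- The usual assumptions on a filtration: right-continuity, and all negligible
sets belong to `𝓕 0`. -/
structure UsualConditions {Ω : Type*} {mΩ : MeasurableSpace Ω} (P : Measure Ω)
    (𝓕 : Filtration ℝ≥0 mΩ) : Prop where
  rightCont : 𝓕.IsRightContinuous
  complete : ∀ A : Set Ω, P A = 0 → MeasurableSet[𝓕 0] A

/-- The covariance setting: `J` is the inclusion `L²(D) ⊂ U`, `Q` is a non-negative symmetric
trace class operator on `U`, `(e_j)` is an orthonormal basis of `U` with `Q e_j = λ_j e_j`, and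
`S : U → L²(D)` is `Q^{1/2}` regarded as a map into `L²(D)`: the composition `J ∘ S` is the
non-negative symmetric square root of `Q`, and `Q^{1/2}(U) = L²(D)`. -/
structure CovarianceSetting {d : ℕ} (D : Set (Euc d)) {U : Type*} [NormedAddCommGroup U]
    [InnerProductSpace ℝ U] [CompleteSpace U] (J : L2 D →L[ℝ] U) (Q : U →L[ℝ] U)
    (S : U →L[ℝ] L2 D) (e : HilbertBasis ℕ ℝ U) (lam : ℕ → ℝ) : Prop where
  inclusion_injective : Function.Injective J
  nonneg_symm : Q.IsPositive
  eigen : ∀ j, Q (e j) = lam j • e j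
  eigen_nonneg : ∀ j, 0 ≤ lam j
  traceClass : Summable lam
  sqrt_nonneg_symm : (J ∘L S).IsPositive
  sqrt_sq : (J ∘L S) ∘L (J ∘L S) = Q
  sqrt_range : Function.Surjective S

/-- The hypothesis on the noise coefficient: `G : L²(D) → HS(L²(D))` with
`G(v)(Q^{1/2} e_j) = g_j(v)`, where the `g_j : ℝ → ℝ` are continuous with support in `(0,1)` and
`∑_j |g_j(r) - g_j(s)|² ≤ L_g |r - s|²`. -/
structure NoiseCoefficient {d : ℕ} (D : Set (Euc d)) {U : Type*} [NormedAddCommGroup U]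
    [InnerProductSpace ℝ U] [CompleteSpace U] (S : U →L[ℝ] L2 D) (e : HilbertBasis ℕ ℝ U)
    (G : L2 D → (L2 D →L[ℝ] L2 D)) (g : ℕ → ℝ → ℝ) (Lg : ℝ) : Prop where
  hilbertSchmidt : ∀ v, IsHilbertSchmidt (G v)
  apply_basis : ∀ v j, ∀ᵐ x ∂(volume.restrict D), G v (S (e j)) x = g j (v x)
  continuous : ∀ j, Continuous (g j)
  support : ∀ j, tsupport (g j) ⊆ Set.Ioo 0 1
  const_nonneg : 0 ≤ Lg
  summable : ∀ r s, Summable fun j => |g j r - g j s| ^ 2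
  lipschitz : ∀ r s, ∑' j, |g j r - g j s| ^ 2 ≤ Lg * |r - s| ^ 2

/-- `B` is a real-valued Wiener process with respect to the filtration `𝓕`. -/
structure IsWienerProcess {Ω : Type*} {mΩ : MeasurableSpace Ω} (P : Measure Ω)
    (𝓕 : Filtration ℝ≥0 mΩ) (B : ℝ≥0 → Ω → ℝ) : Prop where
  brownian : IsBrownianReal B P
  adapted : StronglyAdapted 𝓕 B
  indep : ∀ s t : ℝ≥0, s ≤ t →
    Indep (MeasurableSpace.comap (fun ω => B t ω - B s ω) inferInstance) (𝓕 s) P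

/-- The hypothesis on the driving noise: the `W j` are independent real-valued Wiener processes
with respect to `𝓕`, and `𝒲(t) = ∑_j W_j(t) Q^{1/2} e_j` with convergence in `L²(Ω; U)`. -/
structure DrivingNoise {Ω : Type*} {mΩ : MeasurableSpace Ω} (P : Measure Ω)
    (𝓕 : Filtration ℝ≥0 mΩ) {d : ℕ} (D : Set (Euc d)) {U : Type*} [NormedAddCommGroup U]
    [InnerProductSpace ℝ U] [CompleteSpace U] (J : L2 D →L[ℝ] U) (S : U →L[ℝ] L2 D)
    (e : HilbertBasis ℕ ℝ U) (W : ℕ → ℝ≥0 → Ω → ℝ) (calW : ℝ≥0 → Ω → U) : Prop where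
  wiener : ∀ j, IsWienerProcess P 𝓕 (W j)
  indep : iIndepFun (fun j ω t => W j t ω) P
  series : ∀ t, MemLp (calW t) 2 P ∧
    Tendsto (fun k : ℕ => eLpNorm
      (fun ω => ∑ j ∈ Finset.range k, W j t ω • J (S (e j)) - calW t ω) 2 P) atTop (𝓝 0)

/-- `N` is the noise increment `G(v) (𝒲(b) - 𝒲(a)) = ∑_j G(v)(Q^{1/2} e_j) (W_j(b) - W_j(a))`,
i.e. the stochastic integral `∫_a^b G(v) d𝒲` of the random variable `v`;
the series converges in `L²(Ω; L²(D))`. -/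
def IsNoiseIncrement {Ω : Type*} {mΩ : MeasurableSpace Ω} (P : Measure Ω)
    {d : ℕ} {D : Set (Euc d)} {U : Type*} [NormedAddCommGroup U]
    [InnerProductSpace ℝ U] [CompleteSpace U] (S : U →L[ℝ] L2 D)
    (e : HilbertBasis ℕ ℝ U) (G : L2 D → (L2 D →L[ℝ] L2 D)) (W : ℕ → ℝ≥0 → Ω → ℝ)
    (a b : ℝ≥0) (v : Ω → L2 D) (N : Ω → L2 D) : Prop :=
  MemLp N 2 P ∧
    Tendsto (fun k : ℕ => eLpNorm
      (fun ω => ∑ j ∈ Finset.range k, (W j b ω - W j a ω) • G (v ω) (S (e j)) - N ω) 2 P)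
      atTop (𝓝 0)

/-- The time average `(b - a)⁻¹ ∫_a^b f(s, ω) ds` in `L²(D)`. -/
def timeAverage {Ω : Type*} {d : ℕ} {D : Set (Euc d)} (f : ℝ≥0 → Ω → L2 D) (a b : ℝ≥0)
    (ω : Ω) : L2 D :=
  ((b : ℝ) - a)⁻¹ • ∫ s in (a : ℝ)..b, f s.toNNReal ω

/-- The equation of one step of the scheme, for deterministic values: `u ∈ V`, and
`u - uPrev + τ (Δ_p^N u + ψ_ε(u)) = N + τ (β(u) + F)` holds in `L²(D)`. -/
def StepEquation {d : ℕ} {D : Set (Euc d)} {p : ℝ≥0∞} [Fact (1 ≤ p)] (ε τ : ℝ) (β : ℝ → ℝ)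
    (uPrev N F : L2 D) (u : W1p D p) : Prop :=
  ∃ h : L2 D, IsPLaplaceN u h ∧ ∀ᵐ x ∂(volume.restrict D),
    W1p.toFn u x - uPrev x + τ * (h x + psiMY ε (W1p.toFn u x)) = N x + τ * (β (W1p.toFn u x) + F x)

/-- `u` is a solution of one step of the semi-implicit Euler–Maruyama scheme, from time `a` to
time `b`, starting from `v`: it is an `𝓕 b`-measurable random variable with values in `V` and
satisfies the equation of the step almost surely. -/
def IsStepSolution {Ω : Type*} {mΩ : MeasurableSpace Ω} (P : Measure Ω)
    (𝓕 : Filtration ℝ≥0 mΩ) {d : ℕ} {D : Set (Euc d)} {p : ℝ≥0∞} [Fact (1 ≤ p)]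
    {U : Type*} [NormedAddCommGroup U] [InnerProductSpace ℝ U] [CompleteSpace U]
    (S : U →L[ℝ] L2 D) (e : HilbertBasis ℕ ℝ U) (G : L2 D → (L2 D →L[ℝ] L2 D))
    (W : ℕ → ℝ≥0 → Ω → ℝ) (β : ℝ → ℝ) (f : ℝ≥0 → Ω → L2 D) (ε : ℝ) (a b : ℝ≥0)
    (v : Ω → L2 D) (u : Ω → W1p D p) : Prop :=
  StronglyMeasurable[𝓕 b] u ∧
    ∃ N : Ω → L2 D, IsNoiseIncrement P S e G W a b v N ∧
      ∀ᵐ ω ∂P, StepEquation ε ((b : ℝ) - a) β (v ω) (N ω) (timeAverage f a b ω) (u ω)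

end

/-!
Fix `ω`. Since `W^{1,p}(D) ⊆ L²(D)` on a bounded domain, the equation of one step says that
`τ Δ_p^N u + ι* m(ι u) = ι* b`, where `ι : W^{1,p}(D) → L²(D)` is the inclusion,
`m(x) = x + τ ψ_ε(x) - τ β(x)` and `b = u_n + N + τ f_n`. The scalar function `m` is Lipschitz and,
because `τ L_β < 1`, strongly increasing. Hence `m = κ + k` with `κ` large and `k` Lipschitz with a
constant smaller than `κ`.

The operator `Δ_p^N` is the subgradient of `‖u‖ ^ p / p` for the norm of `W^{1,p}(D)`, which
satisfies the Clarkson inequality for `p ≥ 2`. For `k = 0` the equation is solved by minimizing a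
uniformly convex functional (`IsNormPowGradient.exists_solution_linear`), where the Clarkson
inequality turns minimizing sequences into Cauchy sequences, so that neither weak compactness nor
the theory of monotone operators is needed. The general case is a contraction on `L²(D)`
(`IsNormPowGradient.exists_solution`). The Clarkson inequality also gives
strong monotonicity, hence uniqueness and Hölder continuity of the solution in `b`
(`IsNormPowGradient.continuous_solution`). So the random solution is a continuous function of the
random right-hand side, and measurability and almost sure uniqueness follow.

It remains that the noise series converges in `L²(Ω; L²(D))` to a limit measurable at the end of
the step. Its terms are orthogonal: `E[ΔW_i ΔW_j X] = 0` for `i ≠ j` and `X` bounded and measurable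
at the start of the step (`IsWienerProcess.integral_sub_mul_sub_mul_of_indepFun`). Their squared
norms are summable since `∑_j |g_j(r)|² ≤ L_g`, the `g_j` being supported in `(0, 1)`.
-/

/-! ### Monotone operators that are gradients of `‖u‖ ^ r / r` -/

/-- `A u w` is the pairing `⟨A u, w⟩` of an operator `A : X → X*` that is the subgradient of
`u ↦ ‖u‖ ^ r / r`, on a space whose norm satisfies the Clarkson inequality with exponent `r`.
Of the linearity of `A u`, only the homogeneity is recorded: linearity is not needed. -/
structure IsNormPowGradient {X : Type*} [NormedAddCommGroup X] [NormedSpace ℝ X]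
    (r : ℝ) (A : X → X → ℝ) : Prop where
  two_le : 2 ≤ r
  clarkson : ∀ u v : X, ‖(1 / 2 : ℝ) • (u + v)‖ ^ r + ‖(1 / 2 : ℝ) • (u - v)‖ ^ r
    ≤ (‖u‖ ^ r + ‖v‖ ^ r) / 2
  smul_right : ∀ (u w : X) (c : ℝ), A u (c • w) = c * A u w
  gradient : ∀ u w : X, r * A u (w - u) ≤ ‖w‖ ^ r - ‖u‖ ^ r
  hemicontinuous : ∀ u w : X, Tendsto (fun t : ℝ => A (u + t • w) w) (𝓝[>] 0) (𝓝 (A u w))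

/-- A continuous functional that is bounded below and uniformly midpoint convex attains its
minimum: minimizing sequences are Cauchy. -/
lemma exists_forall_le_of_midpoint {X : Type*} [NormedAddCommGroup X] [NormedSpace ℝ X]
    [CompleteSpace X] {F : X → ℝ} (hF : Continuous F) (hb : BddBelow (Set.range F))
    {c r : ℝ} (hc : 0 < c) (hr : 0 < r)
    (hmid : ∀ u v, F ((1 / 2 : ℝ) • (u + v)) + c * ‖u - v‖ ^ r ≤ (F u + F v) / 2) :
    ∃ u, ∀ v, F u ≤ F v := by
  set I := ⨅ u, F u with hI
  have hle : ∀ u, I ≤ F u := fun u => ciInf_le hb u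
  have hseq : ∀ n : ℕ, ∃ u, F u < I + 1 / ((n : ℝ) + 1) := fun n =>
    exists_lt_of_ciInf_lt (lt_add_of_pos_right _ Nat.one_div_pos_of_nat)
  choose x hx using hseq
  have hδ : Tendsto (fun n : ℕ => 1 / ((n : ℝ) + 1)) atTop (𝓝 0) :=
    tendsto_one_div_add_atTop_nhds_zero_nat
  have hcau : CauchySeq x := by
    have hb0 : Tendsto (fun n : ℕ => ((1 / ((n : ℝ) + 1)) / c) ^ (1 / r)) atTop (𝓝 0) := by
      have := ((hδ.div_const c).rpow_const (p := 1 / r) (Or.inr (by positivity)))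
      simpa [Real.zero_rpow (inv_ne_zero hr.ne')] using this
    refine cauchySeq_of_le_tendsto_0 _ (fun n m N hn hm => ?_) hb0
    have hnN : 1 / ((n : ℝ) + 1) ≤ 1 / ((N : ℝ) + 1) := Nat.one_div_le_one_div hn
    have hmN : 1 / ((m : ℝ) + 1) ≤ 1 / ((N : ℝ) + 1) := Nat.one_div_le_one_div hm
    have h1 := hmid (x n) (x m)
    have h2 := hle ((1 / 2 : ℝ) • (x n + x m))
    have h3 : c * ‖x n - x m‖ ^ r ≤ 1 / ((N : ℝ) + 1) := by
      linarith [hx n, hx m]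
    rw [dist_eq_norm]
    have h4 : ‖x n - x m‖ ^ r ≤ (1 / ((N : ℝ) + 1)) / c := by
      rw [le_div_iff₀ hc]; linarith
    calc ‖x n - x m‖ = (‖x n - x m‖ ^ r) ^ (1 / r) := by
          rw [← Real.rpow_mul (norm_nonneg _), mul_one_div_cancel hr.ne', Real.rpow_one]
      _ ≤ _ := Real.rpow_le_rpow (by positivity) h4 (by positivity)
  obtain ⟨u, hu⟩ := cauchySeq_tendsto_of_complete hcau
  refine ⟨u, fun v => ?_⟩
  refine le_trans ?_ (hle v)
  have h1 : Tendsto (fun n => F (x n)) atTop (𝓝 (F u)) := (hF.tendsto u).comp hu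
  have h2 : Tendsto (fun n : ℕ => I + 1 / ((n : ℝ) + 1)) atTop (𝓝 I) := by
    simpa using hδ.const_add I
  exact le_of_tendsto_of_tendsto' h1 h2 fun n => (hx n).le

namespace IsNormPowGradient

variable {X H : Type*} [NormedAddCommGroup X] [NormedSpace ℝ X]
  [NormedAddCommGroup H] [InnerProductSpace ℝ H] {r : ℝ} {A : X → X → ℝ}

lemma neg_right (hA : IsNormPowGradient r A) (u w : X) : A u (-w) = -A u w := by
  have := hA.smul_right u w (-1)
  simpa using this

/-- Strong monotonicity, by comparing `u` and `v` with their midpoint. -/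
lemma monotone (hA : IsNormPowGradient r A) (u v : X) :
    4 / r * ‖(1 / 2 : ℝ) • (u - v)‖ ^ r ≤ A u (u - v) - A v (u - v) := by
  have hr : 0 < r := by linarith [hA.two_le]
  have h1 := hA.gradient u ((1 / 2 : ℝ) • (u + v))
  have h2 := hA.gradient v ((1 / 2 : ℝ) • (u + v))
  have e1 : (1 / 2 : ℝ) • (u + v) - u = (-(1 / 2) : ℝ) • (u - v) := by module
  have e2 : (1 / 2 : ℝ) • (u + v) - v = (1 / 2 : ℝ) • (u - v) := by module
  rw [e1, hA.smul_right] at h1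
  rw [e2, hA.smul_right] at h2
  have h3 := hA.clarkson u v
  rw [div_mul_eq_mul_div, div_le_iff₀ hr]
  nlinarith

/-- The linear equation `τ A u + κ ι* ι u = ι* b`, solved by minimizing
`τ / r ‖u‖ ^ r + κ / 2 ‖ι u‖² - ⟪b, ι u⟫`. -/
lemma exists_solution_linear [CompleteSpace X] (hA : IsNormPowGradient r A) (ι : X →L[ℝ] H)
    {τ κ : ℝ} (hτ : 0 < τ) (hκ : 0 < κ) (b : H) :
    ∃ u : X, ∀ w : X, τ * A u w + κ * ⟪ι u, ι w⟫_ℝ = ⟪b, ι w⟫_ℝ := by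
  have hr2 := hA.two_le
  have hr : 0 < r := by linarith
  let F : X → ℝ := fun u => τ / r * ‖u‖ ^ r + κ / 2 * ‖ι u‖ ^ 2 - ⟪b, ι u⟫_ℝ
  have hFc : Continuous F := by
    have h1 : Continuous fun u : X => ‖u‖ ^ r := continuous_norm.rpow_const fun _ => Or.inr hr.le
    fun_prop
  have hFb : BddBelow (Set.range F) := by
    refine ⟨-(‖b‖ ^ 2 / (2 * κ)), ?_⟩
    rintro _ ⟨u, rfl⟩
    have h1 : ⟪b, ι u⟫_ℝ ≤ ‖b‖ * ‖ι u‖ := real_inner_le_norm _ _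
    have h2 : 0 ≤ τ / r * ‖u‖ ^ r := by positivity
    have h3 : ‖b‖ * ‖ι u‖ ≤ κ / 2 * ‖ι u‖ ^ 2 + ‖b‖ ^ 2 / (2 * κ) := by
      have : 0 ≤ (κ * ‖ι u‖ - ‖b‖) ^ 2 / (2 * κ) := by positivity
      have e : (κ * ‖ι u‖ - ‖b‖) ^ 2 / (2 * κ)
          = κ / 2 * ‖ι u‖ ^ 2 + ‖b‖ ^ 2 / (2 * κ) - ‖b‖ * ‖ι u‖ := by
        field_simp; ring
      linarith
    show _ ≤ τ / r * ‖u‖ ^ r + κ / 2 * ‖ι u‖ ^ 2 - ⟪b, ι u⟫_ℝ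
    linarith
  have hmid : ∀ u v, F ((1 / 2 : ℝ) • (u + v)) + (τ / r * (1 / 2) ^ r) * ‖u - v‖ ^ r
      ≤ (F u + F v) / 2 := by
    intro u v
    have h1 := hA.clarkson u v
    have e1 : ‖(1 / 2 : ℝ) • (u - v)‖ ^ r = (1 / 2) ^ r * ‖u - v‖ ^ r := by
      rw [norm_smul, Real.mul_rpow (norm_nonneg _) (norm_nonneg _)]; norm_num
    rw [e1] at h1
    have h2 : ‖ι ((1 / 2 : ℝ) • (u + v))‖ ^ 2 ≤ (‖ι u‖ ^ 2 + ‖ι v‖ ^ 2) / 2 := by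
      have := parallelogram_law_with_norm ℝ (ι u) (ι v)
      have hn : 0 ≤ ‖ι u - ι v‖ * ‖ι u - ι v‖ := by positivity
      rw [map_smul, map_add, norm_smul]
      norm_num
      nlinarith
    have h3 : ⟪b, ι ((1 / 2 : ℝ) • (u + v))⟫_ℝ = (⟪b, ι u⟫_ℝ + ⟪b, ι v⟫_ℝ) / 2 := by
      rw [map_smul, map_add, inner_smul_right, inner_add_right]; ring
    show τ / r * ‖(1 / 2 : ℝ) • (u + v)‖ ^ r + κ / 2 * ‖ι ((1 / 2 : ℝ) • (u + v))‖ ^ 2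
        - ⟪b, ι ((1 / 2 : ℝ) • (u + v))⟫_ℝ + (τ / r * (1 / 2) ^ r) * ‖u - v‖ ^ r
      ≤ (τ / r * ‖u‖ ^ r + κ / 2 * ‖ι u‖ ^ 2 - ⟪b, ι u⟫_ℝ
        + (τ / r * ‖v‖ ^ r + κ / 2 * ‖ι v‖ ^ 2 - ⟪b, ι v⟫_ℝ)) / 2
    have h4 := mul_le_mul_of_nonneg_left h1 (by positivity : 0 ≤ τ / r)
    have h5 := mul_le_mul_of_nonneg_left h2 (by positivity : 0 ≤ κ / 2)
    linarith
  obtain ⟨u, hu⟩ := exists_forall_le_of_midpoint hFc hFb (by positivity) hr hmid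
  -- The one-sided variational inequality, from the subgradient inequality at `u + t • w`.
  have key : ∀ w : X, 0 ≤ τ * A u w + κ * ⟪ι u, ι w⟫_ℝ - ⟪b, ι w⟫_ℝ := by
    intro w
    have hlim : Tendsto (fun t : ℝ => τ * A (u + t • w) w + κ * ⟪ι u, ι w⟫_ℝ
        + t * (κ / 2 * ‖ι w‖ ^ 2) - ⟪b, ι w⟫_ℝ) (𝓝[>] 0)
        (𝓝 (τ * A u w + κ * ⟪ι u, ι w⟫_ℝ + 0 * (κ / 2 * ‖ι w‖ ^ 2) - ⟪b, ι w⟫_ℝ)) := by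
      have ht : Tendsto (fun t : ℝ => t) (𝓝[>] 0) (𝓝 0) := nhdsWithin_le_nhds
      exact ((((hA.hemicontinuous u w).const_mul τ).add_const _).add
        (ht.mul_const _)).sub_const _
    rw [zero_mul, add_zero] at hlim
    refine ge_of_tendsto hlim ?_
    filter_upwards [self_mem_nhdsWithin] with t ht
    have ht : 0 < t := ht
    have h1 := hA.gradient (u + t • w) u
    have e1 : u - (u + t • w) = (-t) • w := by module
    rw [e1, hA.smul_right] at h1
    have h2 : τ / r * ‖u‖ ^ r + κ / 2 * ‖ι u‖ ^ 2 - ⟪b, ι u⟫_ℝ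
      ≤ τ / r * ‖u + t • w‖ ^ r + κ / 2 * ‖ι (u + t • w)‖ ^ 2 - ⟪b, ι (u + t • w)⟫_ℝ :=
      hu (u + t • w)
    have h3 : ‖ι (u + t • w)‖ ^ 2 = ‖ι u‖ ^ 2 + 2 * (t * ⟪ι u, ι w⟫_ℝ) + t ^ 2 * ‖ι w‖ ^ 2 := by
      rw [map_add, map_smul, norm_add_sq_real, inner_smul_right, norm_smul, mul_pow]
      simp
    have h4 : ⟪b, ι (u + t • w)⟫_ℝ = ⟪b, ι u⟫_ℝ + t * ⟪b, ι w⟫_ℝ := by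
      rw [map_add, map_smul, inner_add_right, inner_smul_right]
    rw [h3, h4] at h2
    have h5 : τ / r * ‖u + t • w‖ ^ r - τ / r * ‖u‖ ^ r ≤ τ * t * A (u + t • w) w := by
      have := mul_le_mul_of_nonneg_left h1 (by positivity : 0 ≤ τ / r)
      have e : τ / r * (r * (-t * A (u + t • w) w)) = -(τ * t * A (u + t • w) w) := by
        field_simp
      linarith
    have h6 : 0 ≤ t * (τ * A (u + t • w) w + κ * ⟪ι u, ι w⟫_ℝ
        + t * (κ / 2 * ‖ι w‖ ^ 2) - ⟪b, ι w⟫_ℝ) := by nlinarith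
    exact nonneg_of_mul_nonneg_right h6 ht
  refine ⟨u, fun w => le_antisymm ?_ ?_⟩
  · have := key (-w)
    rw [hA.neg_right, map_neg, inner_neg_right, inner_neg_right] at this
    linarith
  · linarith [key w]

/-- Stability of the equation `τ A u + ι* (κ + k) (ι u) = ι* b` with respect to `b`, for a
Lipschitz perturbation `k` that is dominated by `κ`. -/
lemma stability (hA : IsNormPowGradient r A) (ι : X →L[ℝ] H) {τ κ : ℝ} (hτ : 0 ≤ τ)
    {k : H → H} {K : ℝ≥0} (hk : LipschitzWith K k) {b₁ b₂ : H} {u₁ u₂ : X}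
    (h₁ : ∀ w : X, τ * A u₁ w + κ * ⟪ι u₁, ι w⟫_ℝ + ⟪k (ι u₁), ι w⟫_ℝ = ⟪b₁, ι w⟫_ℝ)
    (h₂ : ∀ w : X, τ * A u₂ w + κ * ⟪ι u₂, ι w⟫_ℝ + ⟪k (ι u₂), ι w⟫_ℝ = ⟪b₂, ι w⟫_ℝ) :
    τ * (4 / r * ‖(1 / 2 : ℝ) • (u₁ - u₂)‖ ^ r) + (κ - K) * ‖ι u₁ - ι u₂‖ ^ 2
      ≤ ‖b₁ - b₂‖ * ‖ι u₁ - ι u₂‖ := by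
  have e1 := h₁ (u₁ - u₂)
  have e2 := h₂ (u₁ - u₂)
  rw [map_sub] at e1 e2
  have hm := mul_le_mul_of_nonneg_left (hA.monotone u₁ u₂) hτ
  have hb : ⟪b₁, ι u₁ - ι u₂⟫_ℝ - ⟪b₂, ι u₁ - ι u₂⟫_ℝ ≤ ‖b₁ - b₂‖ * ‖ι u₁ - ι u₂‖ := by
    rw [← inner_sub_left]; exact real_inner_le_norm _ _
  have hkk : -(K * ‖ι u₁ - ι u₂‖ ^ 2)
      ≤ ⟪k (ι u₁), ι u₁ - ι u₂⟫_ℝ - ⟪k (ι u₂), ι u₁ - ι u₂⟫_ℝ := by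
    rw [← inner_sub_left]
    have h1 := (abs_le.1 (abs_real_inner_le_norm (k (ι u₁) - k (ι u₂)) (ι u₁ - ι u₂))).1
    have h2 := hk.norm_sub_le (ι u₁) (ι u₂)
    nlinarith [norm_nonneg (ι u₁ - ι u₂)]
  have hs : ⟪ι u₁, ι u₁ - ι u₂⟫_ℝ - ⟪ι u₂, ι u₁ - ι u₂⟫_ℝ = ‖ι u₁ - ι u₂‖ ^ 2 := by
    rw [← inner_sub_left, real_inner_self_eq_norm_sq]
  have hs' : κ * ⟪ι u₁, ι u₁ - ι u₂⟫_ℝ - κ * ⟪ι u₂, ι u₁ - ι u₂⟫_ℝ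
      = κ * ‖ι u₁ - ι u₂‖ ^ 2 := by rw [← hs]; ring
  linarith

/-- The equation `τ A u + ι* (κ + k) (ι u) = ι* b`, solved by the contraction that sends `z : H`
to the solution of `τ A u + κ ι* ι u = ι* (b - k z)`. -/
lemma exists_solution [CompleteSpace X] [CompleteSpace H] (hA : IsNormPowGradient r A)
    (ι : X →L[ℝ] H) {τ κ : ℝ} (hτ : 0 < τ) {k : H → H} {K : ℝ≥0} (hk : LipschitzWith K k)
    (hKκ : K < κ) (b : H) :
    ∃ u : X, ∀ w : X, τ * A u w + κ * ⟪ι u, ι w⟫_ℝ + ⟪k (ι u), ι w⟫_ℝ = ⟪b, ι w⟫_ℝ := by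
  have hr : 0 < r := by linarith [hA.two_le]
  have hκ : 0 < κ := lt_of_le_of_lt K.2 hKκ
  choose s hs using fun z : H => hA.exists_solution_linear ι hτ hκ (b - k z)
  let q : ℝ≥0 := ⟨K / κ, by positivity⟩
  have hcontr : ContractingWith q fun z => ι (s z) := by
    refine ⟨?_, LipschitzWith.of_dist_le_mul fun z₁ z₂ => ?_⟩
    · rw [← NNReal.coe_lt_coe]; exact (div_lt_one hκ).2 hKκ
    · have hst := hA.stability ι hτ.le (LipschitzWith.const (0 : H)) (κ := κ)
        (b₁ := b - k z₁) (b₂ := b - k z₂) (u₁ := s z₁) (u₂ := s z₂)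
        (fun w => by rw [inner_zero_left, add_zero]; exact hs z₁ w)
        (fun w => by rw [inner_zero_left, add_zero]; exact hs z₂ w)
      have h0 : 0 ≤ τ * (4 / r * ‖(1 / 2 : ℝ) • (s z₁ - s z₂)‖ ^ r) := by positivity
      have hb : ‖b - k z₁ - (b - k z₂)‖ ≤ K * ‖z₁ - z₂‖ := by
        rw [sub_sub_sub_cancel_left, norm_sub_rev]
        exact hk.norm_sub_le _ _
      rw [dist_eq_norm, dist_eq_norm]
      show _ ≤ K / κ * _
      rw [div_mul_eq_mul_div, le_div_iff₀ hκ]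
      rcases (norm_nonneg (ι (s z₁) - ι (s z₂))).eq_or_lt with h | h
      · rw [← h, zero_mul]; positivity
      · have h3 := mul_le_mul_of_nonneg_right hb h.le
        refine le_of_mul_le_mul_right ?_ h
        simp only [NNReal.coe_zero, sub_zero] at hst
        nlinarith
  have hfix : ι (s (hcontr.fixedPoint)) = hcontr.fixedPoint := hcontr.fixedPoint_isFixedPt
  refine ⟨s hcontr.fixedPoint, fun w => ?_⟩
  have := hs hcontr.fixedPoint w
  rw [inner_sub_left] at this
  rw [hfix] at this ⊢
  linarith

lemma solution_unique (hA : IsNormPowGradient r A) (ι : X →L[ℝ] H) {τ κ : ℝ} (hτ : 0 < τ)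
    {k : H → H} {K : ℝ≥0} (hk : LipschitzWith K k) (hKκ : K < κ) {b : H} {u₁ u₂ : X}
    (h₁ : ∀ w : X, τ * A u₁ w + κ * ⟪ι u₁, ι w⟫_ℝ + ⟪k (ι u₁), ι w⟫_ℝ = ⟪b, ι w⟫_ℝ)
    (h₂ : ∀ w : X, τ * A u₂ w + κ * ⟪ι u₂, ι w⟫_ℝ + ⟪k (ι u₂), ι w⟫_ℝ = ⟪b, ι w⟫_ℝ) :
    u₁ = u₂ := by
  have hr : 0 < r := by linarith [hA.two_le]
  have h := hA.stability ι hτ.le hk h₁ h₂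
  rw [sub_self, norm_zero, zero_mul] at h
  have h1 : 0 ≤ (κ - K) * ‖ι u₁ - ι u₂‖ ^ 2 := mul_nonneg (by linarith) (by positivity)
  by_contra hne
  have hpos : 0 < ‖(1 / 2 : ℝ) • (u₁ - u₂)‖ :=
    norm_pos_iff.2 (smul_ne_zero (by norm_num) (sub_ne_zero.2 hne))
  have h2 : 0 < τ * (4 / r * ‖(1 / 2 : ℝ) • (u₁ - u₂)‖ ^ r) := by positivity
  linarith

/-- The solution depends on the right-hand side `b` in a Hölder continuous way, with exponent
`1 / (r - 1)`. -/
lemma continuous_solution (hA : IsNormPowGradient r A) (ι : X →L[ℝ] H) {τ κ : ℝ} (hτ : 0 < τ)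
    {k : H → H} {K : ℝ≥0} (hk : LipschitzWith K k) (hKκ : K < κ) {s : H → X}
    (hs : ∀ (b : H) (w : X),
      τ * A (s b) w + κ * ⟪ι (s b), ι w⟫_ℝ + ⟪k (ι (s b)), ι w⟫_ℝ = ⟪b, ι w⟫_ℝ) :
    Continuous s := by
  have hr2 := hA.two_le
  have hr : 0 < r := by linarith
  have hr1 : 0 < r - 1 := by linarith
  set C : ℝ := τ * (4 / r * (1 / 2) ^ r) with hC
  have hCpos : 0 < C := by positivity
  have hbound : ∀ b₁ b₂, ‖s b₁ - s b₂‖ ≤ (‖b₁ - b₂‖ * ‖ι‖ / C) ^ (1 / (r - 1)) := by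
    intro b₁ b₂
    rcases (norm_nonneg (s b₁ - s b₂)).eq_or_lt with h | h
    · rw [← h]; positivity
    have hst := hA.stability ι hτ.le hk (hs b₁) (hs b₂)
    have h1 : 0 ≤ (κ - K) * ‖ι (s b₁) - ι (s b₂)‖ ^ 2 :=
      mul_nonneg (by linarith) (by positivity)
    have e1 : ‖(1 / 2 : ℝ) • (s b₁ - s b₂)‖ ^ r
        = (1 / 2) ^ r * (‖s b₁ - s b₂‖ ^ (r - 1) * ‖s b₁ - s b₂‖) := by
      rw [norm_smul, Real.mul_rpow (norm_nonneg _) (norm_nonneg _), ← Real.rpow_add_one h.ne']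
      norm_num
    have h2 : ‖ι (s b₁) - ι (s b₂)‖ ≤ ‖ι‖ * ‖s b₁ - s b₂‖ := by
      rw [← map_sub]; exact ι.le_opNorm _
    have h3 : ‖s b₁ - s b₂‖ ^ (r - 1) ≤ ‖b₁ - b₂‖ * ‖ι‖ / C := by
      rw [le_div_iff₀ hCpos]
      refine le_of_mul_le_mul_right ?_ h
      have h4 := mul_le_mul_of_nonneg_left h2 (norm_nonneg (b₁ - b₂))
      rw [e1] at hst
      have e2 : ‖s b₁ - s b₂‖ ^ (r - 1) * C * ‖s b₁ - s b₂‖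
        = τ * (4 / r * ((1 / 2) ^ r * (‖s b₁ - s b₂‖ ^ (r - 1) * ‖s b₁ - s b₂‖))) := by
        rw [hC]; ring
      rw [e2]
      linarith
    calc ‖s b₁ - s b₂‖ = (‖s b₁ - s b₂‖ ^ (r - 1)) ^ (1 / (r - 1)) := by
          rw [← Real.rpow_mul (norm_nonneg _), mul_one_div_cancel hr1.ne', Real.rpow_one]
      _ ≤ _ := Real.rpow_le_rpow (by positivity) h3 (by positivity)
  refine continuous_iff_continuousAt.2 fun b => tendsto_iff_norm_sub_tendsto_zero.2 ?_
  refine squeeze_zero (fun _ => norm_nonneg _) (fun b' => hbound b' b) ?_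
  have hc : Continuous fun b' : H => (‖b' - b‖ * ‖ι‖ / C) ^ (1 / (r - 1)) :=
    Continuous.rpow_const (by fun_prop) fun _ => Or.inr (by positivity)
  have := hc.tendsto b
  simpa [Real.zero_rpow (inv_ne_zero hr1.ne')] using this

end IsNormPowGradient

/-! ### The `p`-duality map of `L^p` -/

section Pointwise

variable {E : Type*} [NormedAddCommGroup E] [InnerProductSpace ℝ E]

/-- Pointwise Clarkson inequality: the parallelogram law, followed by the superadditivity and the
convexity of `t ↦ t ^ (r / 2)`. -/
lemma norm_rpow_clarkson {r : ℝ} (hr : 2 ≤ r) (a b : E) :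
    ‖(1 / 2 : ℝ) • (a + b)‖ ^ r + ‖(1 / 2 : ℝ) • (a - b)‖ ^ r ≤ (‖a‖ ^ r + ‖b‖ ^ r) / 2 := by
  have hr2 : 1 ≤ r / 2 := by linarith
  have hpow : ∀ x : E, ‖x‖ ^ r = (‖x‖ ^ 2) ^ (r / 2) := fun x => by
    rw [← Real.rpow_natCast, ← Real.rpow_mul (norm_nonneg _)]
    congr 1; push_cast; ring
  have hpar : ‖(1 / 2 : ℝ) • (a + b)‖ ^ 2 + ‖(1 / 2 : ℝ) • (a - b)‖ ^ 2
      = (1 / 2 : ℝ) * ‖a‖ ^ 2 + (1 / 2 : ℝ) * ‖b‖ ^ 2 := by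
    have := parallelogram_law_with_norm ℝ a b
    rw [norm_smul, norm_smul]
    norm_num
    nlinarith
  obtain ⟨-, hconv⟩ := convexOn_rpow hr2
  replace hconv := hconv (Set.mem_Ici.2 (by positivity : 0 ≤ ‖a‖ ^ 2))
    (Set.mem_Ici.2 (by positivity : 0 ≤ ‖b‖ ^ 2)) (by norm_num : (0 : ℝ) ≤ 1 / 2)
    (by norm_num : (0 : ℝ) ≤ 1 / 2) (by norm_num)
  simp only [smul_eq_mul] at hconv
  calc ‖(1 / 2 : ℝ) • (a + b)‖ ^ r + ‖(1 / 2 : ℝ) • (a - b)‖ ^ r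
      ≤ (‖(1 / 2 : ℝ) • (a + b)‖ ^ 2 + ‖(1 / 2 : ℝ) • (a - b)‖ ^ 2) ^ (r / 2) := by
        rw [hpow, hpow ((1 / 2 : ℝ) • (a - b))]
        exact Real.add_rpow_le_rpow_add (by positivity) (by positivity) hr2
    _ ≤ _ := by
        rw [hpar, hpow a, hpow b]; linarith

/-- `‖a‖ ^ (r - 2) • a` is a subgradient of `‖·‖ ^ r / r` at `a`, by Young's inequality. -/
lemma norm_rpow_subgradient {r : ℝ} (hr : 2 ≤ r) (a b : E) :
    r * (‖a‖ ^ (r - 2) * ⟪a, b - a⟫_ℝ) ≤ ‖b‖ ^ r - ‖a‖ ^ r := by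
  have hr0 : 0 < r := by linarith
  have e0 : ‖a‖ ^ (r - 2) * ‖a‖ ^ 2 = ‖a‖ ^ r := by
    rw [← Real.rpow_natCast, ← Real.rpow_add_of_nonneg (norm_nonneg _) (by linarith) (by norm_num)]
    congr 1; push_cast; ring
  have e1 : ‖a‖ ^ (r - 2) * ‖a‖ = ‖a‖ ^ (r - 1) := by
    rw [← Real.rpow_add_one' (norm_nonneg _) (by linarith)]
    congr 1; ring
  have hc : ‖a‖ ^ (r - 2) * ⟪a, b⟫_ℝ ≤ ‖a‖ ^ (r - 1) * ‖b‖ := by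
    rw [← e1, mul_assoc]
    exact mul_le_mul_of_nonneg_left (real_inner_le_norm _ _) (by positivity)
  have hq : r.HolderConjugate (r / (r - 1)) := Real.HolderConjugate.conjExponent (by linarith)
  have hy := Real.young_inequality_of_nonneg (a := ‖b‖) (b := ‖a‖ ^ (r - 1))
    (norm_nonneg _) (by positivity) hq
  have e2 : (‖a‖ ^ (r - 1)) ^ (r / (r - 1)) = ‖a‖ ^ r := by
    rw [← Real.rpow_mul (norm_nonneg _), mul_div_cancel₀ _ (by linarith)]
  rw [e2] at hy
  have hy2 := mul_le_mul_of_nonneg_left hy hr0.le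
  have e3 : r * (‖b‖ ^ r / r + ‖a‖ ^ r / (r / (r - 1))) = ‖b‖ ^ r + (r - 1) * ‖a‖ ^ r := by
    have : r - 1 ≠ 0 := by linarith
    field_simp
  rw [e3] at hy2
  rw [inner_sub_right, real_inner_self_eq_norm_sq, mul_sub, e0]
  nlinarith

lemma abs_norm_rpow_mul_inner_le {r : ℝ} (hr : 2 ≤ r) {a b : E} {B : ℝ} (ha : ‖a‖ ≤ B)
    (hb : ‖b‖ ≤ B) : ‖‖a‖ ^ (r - 2) * ⟪a, b⟫_ℝ‖ ≤ B ^ r := by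
  have hB : 0 ≤ B := (norm_nonneg a).trans ha
  rw [norm_mul, Real.norm_of_nonneg (by positivity)]
  have h1 : ‖⟪a, b⟫_ℝ‖ ≤ B ^ 2 := by
    refine (abs_real_inner_le_norm a b).trans ?_
    rw [sq]; gcongr
  calc ‖a‖ ^ (r - 2) * ‖⟪a, b⟫_ℝ‖ ≤ B ^ (r - 2) * B ^ 2 := by
        gcongr
    _ = B ^ r := by
        rw [← Real.rpow_natCast, ← Real.rpow_add_of_nonneg hB (by linarith) (by norm_num)]
        congr 1; push_cast; ring

end Pointwise

section Lp

variable {α E : Type*} {mα : MeasurableSpace α} {μ : Measure α} [NormedAddCommGroup E]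
  [InnerProductSpace ℝ E] {p : ℝ≥0∞} [Fact (1 ≤ p)]

omit [InnerProductSpace ℝ E] in
lemma Lp_norm_rpow_eq_integral (hp : p ≠ ⊤) (f : Lp E p μ) :
    ‖f‖ ^ p.toReal = ∫ x, ‖f x‖ ^ p.toReal ∂μ := by
  have hp0 : p ≠ 0 := (zero_lt_one.trans_le Fact.out).ne'
  have hr : 0 < p.toReal := ENNReal.toReal_pos hp0 hp
  have h0 : 0 ≤ ∫ x, ‖f x‖ ^ p.toReal ∂μ := integral_nonneg fun x => by positivity
  rw [Lp.norm_def, (Lp.memLp f).eLpNorm_eq_integral_rpow_norm hp0 hp,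
    ENNReal.toReal_ofReal (by positivity), ← Real.rpow_mul h0, inv_mul_cancel₀ hr.ne',
    Real.rpow_one]

omit [InnerProductSpace ℝ E] in
lemma integrable_norm_add_norm_rpow (hp : p ≠ ⊤) (f g : Lp E p μ) :
    Integrable (fun x => (‖f x‖ + ‖g x‖) ^ p.toReal) μ := by
  have hp0 : p ≠ 0 := (zero_lt_one.trans_le Fact.out).ne'
  have h := ((Lp.memLp f).norm.add (Lp.memLp g).norm).integrable_norm_rpow hp0 hp
  refine h.congr (Eventually.of_forall fun x => ?_)
  simp only [Pi.add_apply]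
  rw [Real.norm_of_nonneg (by positivity)]

/-- The pairing `∫ ‖f‖ ^ (p - 2) ⟪f, g⟫` of `L^p` given by its duality map. -/
noncomputable def lpDuality (f g : Lp E p μ) : ℝ :=
  ∫ x, ‖f x‖ ^ (p.toReal - 2) * ⟪f x, g x⟫_ℝ ∂μ

lemma integrable_lpDuality (hp2 : 2 ≤ p) (hp : p ≠ ⊤) (f g : Lp E p μ) :
    Integrable (fun x => ‖f x‖ ^ (p.toReal - 2) * ⟪f x, g x⟫_ℝ) μ := by
  have hr : 2 ≤ p.toReal := by simpa using ENNReal.toReal_mono hp hp2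
  refine (integrable_norm_add_norm_rpow hp f g).mono' ?_ (Eventually.of_forall fun x => ?_)
  · have hf := (Lp.aestronglyMeasurable f)
    have hg := (Lp.aestronglyMeasurable g)
    exact ((hf.norm.aemeasurable.pow_const _).aestronglyMeasurable).mul (hf.inner hg)
  · exact abs_norm_rpow_mul_inner_le hr (by linarith [norm_nonneg (g x)])
      (by linarith [norm_nonneg (f x)])

/-- In the hemicontinuity, the integrands are dominated by `(‖f‖ + ‖g‖) ^ p`. -/
lemma isNormPowGradient_lpDuality (hp2 : 2 ≤ p) (hp : p ≠ ⊤) :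
    IsNormPowGradient p.toReal (lpDuality : Lp E p μ → Lp E p μ → ℝ) := by
  have hr : 2 ≤ p.toReal := by simpa using ENNReal.toReal_mono hp hp2
  have hp0 : p ≠ 0 := (zero_lt_one.trans_le Fact.out).ne'
  have hint : ∀ f : Lp E p μ, Integrable (fun x => ‖f x‖ ^ p.toReal) μ := fun f =>
    (Lp.memLp f).integrable_norm_rpow hp0 hp
  refine ⟨hr, fun f g => ?_, fun f g c => ?_, fun f g => ?_, fun f g => ?_⟩
  · simp only [Lp_norm_rpow_eq_integral hp]
    rw [← integral_add (hint _) (hint _), ← integral_add (hint _) (hint _), ← integral_div]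
    refine integral_mono_ae ((hint _).add (hint _)) (((hint _).add (hint _)).div_const 2) ?_
    filter_upwards [Lp.coeFn_smul (1 / 2 : ℝ) (f + g), Lp.coeFn_smul (1 / 2 : ℝ) (f - g),
      Lp.coeFn_add f g, Lp.coeFn_sub f g] with x h1 h2 h3 h4
    rw [h1, h2, Pi.smul_apply, Pi.smul_apply, h3, h4]
    exact norm_rpow_clarkson hr (f x) (g x)
  · simp only [lpDuality]
    rw [← integral_const_mul]
    refine integral_congr_ae ?_
    filter_upwards [Lp.coeFn_smul c g] with x h1
    rw [h1, Pi.smul_apply, inner_smul_right]; ring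
  · simp only [lpDuality, Lp_norm_rpow_eq_integral hp]
    rw [← integral_const_mul, ← integral_sub (hint _) (hint _)]
    refine integral_mono_ae ((integrable_lpDuality hp2 hp _ _).const_mul _)
      ((hint _).sub (hint _)) ?_
    filter_upwards [Lp.coeFn_sub g f] with x h1
    rw [h1]
    exact norm_rpow_subgradient hr (f x) (g x)
  · -- For each `t`, the class `f + t • g` is replaced by its pointwise expression.
    have e : ∀ t : ℝ, lpDuality (f + t • g) g
        = ∫ x, ‖f x + t • g x‖ ^ (p.toReal - 2) * ⟪f x + t • g x, g x⟫_ℝ ∂μ := fun t => by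
      refine integral_congr_ae ?_
      filter_upwards [Lp.coeFn_add f (t • g), Lp.coeFn_smul t g] with x h1 h2
      rw [h1, Pi.add_apply, h2, Pi.smul_apply]
    simp only [e]
    refine tendsto_integral_filter_of_dominated_convergence
      (fun x => (‖f x‖ + ‖g x‖) ^ p.toReal) ?_ ?_ (integrable_norm_add_norm_rpow hp f g) ?_
    · refine Eventually.of_forall fun t => ?_
      have hf : AEStronglyMeasurable (fun x => f x + t • g x) μ :=
        (Lp.aestronglyMeasurable f).add ((Lp.aestronglyMeasurable g).const_smul t)
      exact ((hf.norm.aemeasurable.pow_const _).aestronglyMeasurable).mul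
        (hf.inner (Lp.aestronglyMeasurable g))
    · have : Set.Ioo (0 : ℝ) 1 ∈ 𝓝[>] (0 : ℝ) := Ioo_mem_nhdsGT one_pos
      filter_upwards [this] with t ht
      refine Eventually.of_forall fun x => ?_
      refine abs_norm_rpow_mul_inner_le hr ?_ (by linarith [norm_nonneg (f x)])
      refine (norm_add_le _ _).trans ?_
      gcongr
      rw [norm_smul, Real.norm_of_nonneg ht.1.le]
      exact mul_le_of_le_one_left (norm_nonneg _) ht.2.le
    · refine Eventually.of_forall fun x => ?_
      have hc : Continuous fun t : ℝ =>
          ‖f x + t • g x‖ ^ (p.toReal - 2) * ⟪f x + t • g x, g x⟫_ℝ := by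
        refine Continuous.mul (Continuous.rpow_const (by fun_prop) fun _ => Or.inr ?_)
          (by fun_prop)
        linarith
      have := (hc.tendsto 0).mono_left (nhdsWithin_le_nhds (s := Set.Ioi 0))
      simpa using this

end Lp

/-! ### The Sobolev space `W^{1,p}(D)` and the Neumann `p`-Laplacian -/

section Inclusion

variable {α E : Type*} {mα : MeasurableSpace α} {μ : Measure α} [NormedAddCommGroup E]
  [NormedSpace ℝ E] {p q : ℝ≥0∞} [Fact (1 ≤ p)] [Fact (1 ≤ q)]

/-- The continuous inclusion `L^q ⊆ L^p`, `p ≤ q`, over a space of finite measure. -/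
noncomputable def lpInclusion (μ : Measure α) [IsFiniteMeasure μ] (hpq : p ≤ q) :
    Lp E q μ →L[ℝ] Lp E p μ :=
  LinearMap.mkContinuous
    { toFun := fun f => ((Lp.memLp f).mono_exponent hpq).toLp f
      map_add' := fun f g => by
        rw [← MemLp.toLp_add]
        exact MemLp.toLp_congr _ _ (Lp.coeFn_add f g)
      map_smul' := fun c f => by
        rw [RingHom.id_apply, ← MemLp.toLp_const_smul]
        exact MemLp.toLp_congr _ _ (Lp.coeFn_smul c f) }
    (μ Set.univ ^ (1 / p.toReal - 1 / q.toReal)).toReal fun f => by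
      have hexp : 0 ≤ 1 / p.toReal - 1 / q.toReal := by
        by_cases hq : q = ⊤
        · simp [hq]
        · have hp : p ≠ ⊤ := fun h => hq (top_le_iff.1 (h ▸ hpq))
          have hp0 : 0 < p.toReal := ENNReal.toReal_pos (zero_lt_one.trans_le Fact.out).ne' hp
          exact sub_nonneg.2 (one_div_le_one_div_of_le hp0 (ENNReal.toReal_mono hq hpq))
      have hfin : μ Set.univ ^ (1 / p.toReal - 1 / q.toReal) ≠ ⊤ :=
        ENNReal.rpow_ne_top_of_nonneg hexp (measure_ne_top μ _)
      show ‖((Lp.memLp f).mono_exponent hpq).toLp f‖ ≤ _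
      rw [Lp.norm_toLp, Lp.norm_def, mul_comm, ← ENNReal.toReal_mul]
      refine ENNReal.toReal_mono (ENNReal.mul_ne_top (Lp.eLpNorm_ne_top f) hfin) ?_
      exact eLpNorm_le_eLpNorm_mul_rpow_measure_univ hpq (Lp.aestronglyMeasurable f)

lemma coeFn_lpInclusion [IsFiniteMeasure μ] (hpq : p ≤ q) (f : Lp E q μ) :
    lpInclusion μ hpq f =ᵐ[μ] f :=
  MemLp.coeFn_toLp ((Lp.memLp f).mono_exponent hpq)

/-- Integration against a bounded function is continuous on `L^p` of a finite measure. -/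
lemma continuous_integral_mul_of_bounded [IsFiniteMeasure μ] {φ : α → ℝ}
    (hφ : AEStronglyMeasurable φ μ) {C : ℝ} (hC : ∀ x, |φ x| ≤ C) :
    Continuous fun f : Lp ℝ p μ => ∫ x, f x * φ x ∂μ := by
  have hφ2 : MemLp φ ⊤ μ := memLp_top_of_bound hφ C (Eventually.of_forall hC)
  let B : ℝ →L[ℝ] ℝ →L[ℝ] ℝ := ContinuousLinearMap.mul ℝ ℝ
  let Λ : Lp ℝ p μ →L[ℝ] ℝ :=
    ((B.lpPairing μ 1 ⊤).flip (hφ2.toLp φ)).comp (lpInclusion μ (Fact.out : 1 ≤ p))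
  refine Λ.continuous.congr fun f => ?_
  show B.lpPairing μ 1 ⊤ (lpInclusion μ (Fact.out : 1 ≤ p) f) (hφ2.toLp φ) = _
  rw [ContinuousLinearMap.lpPairing_eq_integral]
  refine integral_congr_ae ?_
  filter_upwards [hφ2.coeFn_toLp, coeFn_lpInclusion (μ := μ) (Fact.out : 1 ≤ p) f] with x h1 h2
  rw [h1, h2]; rfl

end Inclusion

section Sobolev

variable {d : ℕ} {D : Set (Euc d)} {p : ℝ≥0∞} [Fact (1 ≤ p)]

/-- Weak gradients pass to limits in `L^p`, so `W^{1,p}(D)` is a Banach space. -/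
lemma isClosed_W1p [IsFiniteMeasure (volume.restrict D)] :
    IsClosed (W1p D p : Set (WithLp p (Lp ℝ p (volume.restrict D) ×
      Lp (Euc d) p (volume.restrict D)))) := by
  have hset : (W1p D p : Set (WithLp p (Lp ℝ p (volume.restrict D) ×
      Lp (Euc d) p (volume.restrict D)))) = {z | IsWeakGradient D z.fst z.snd} := rfl
  rw [hset]
  simp only [IsWeakGradient, Set.ofPred_forall]
  refine isClosed_iInter fun φ => isClosed_iInter fun hφ => isClosed_iInter fun hc =>
    isClosed_iInter fun _ => isClosed_iInter fun v => ?_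
  have hφ' : Continuous fun x => fderiv ℝ φ x v :=
    (hφ.continuous_fderiv (by simp)).clm_apply continuous_const
  obtain ⟨C₁, hC₁⟩ := (hc.fderiv_apply ℝ v).exists_bound_of_continuous hφ'
  obtain ⟨C₂, hC₂⟩ := hc.exists_bound_of_continuous hφ.continuous
  have h1 := continuous_integral_mul_of_bounded (p := p) (μ := volume.restrict D)
    hφ'.aestronglyMeasurable hC₁
  have h2 := continuous_integral_mul_of_bounded (p := p) (μ := volume.restrict D)
    hφ.continuous.aestronglyMeasurable hC₂
  let Λ : Lp (Euc d) p (volume.restrict D) →L[ℝ] Lp ℝ p (volume.restrict D) :=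
    (innerSL ℝ v).compLpL p (volume.restrict D)
  have h3 : Continuous fun g : Lp (Euc d) p (volume.restrict D) =>
      ∫ x in D, ⟪g x, v⟫_ℝ * φ x := by
    refine (h2.comp Λ.continuous).congr fun g => integral_congr_ae ?_
    filter_upwards [ContinuousLinearMap.coeFn_compLpL (innerSL ℝ v) g] with x hx
    rw [hx, innerSL_apply_apply, real_inner_comm]
  exact isClosed_eq (h1.comp (by fun_prop)) (h3.comp (by fun_prop)).neg

lemma W1p_norm_rpow (hp : p ≠ ⊤) (u : W1p D p) :
    ‖u‖ ^ p.toReal = ‖u.1.fst‖ ^ p.toReal + ‖u.1.snd‖ ^ p.toReal := by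
  have hr : 0 < p.toReal := ENNReal.toReal_pos (zero_lt_one.trans_le Fact.out).ne' hp
  show ‖u.1‖ ^ p.toReal = _
  rw [WithLp.prod_norm_eq_add hr, ← Real.rpow_mul (by positivity), one_div_mul_cancel hr.ne',
    Real.rpow_one]

lemma pLaplaceN_eq_add (hp2 : 2 ≤ p) (hp : p ≠ ⊤) (u w : W1p D p) :
    pLaplaceN u w = lpDuality u.1.fst w.1.fst + lpDuality u.1.snd w.1.snd := by
  rw [lpDuality, lpDuality, ← integral_add (integrable_lpDuality hp2 hp _ _)
    (integrable_lpDuality hp2 hp _ _)]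
  refine integral_congr_ae (Eventually.of_forall fun x => ?_)
  simp only [W1p.toFn, W1p.weakGrad, Real.norm_eq_abs, RCLike.inner_apply,
    conj_trivial]
  ring

lemma isNormPowGradient_pLaplaceN (hp2 : 2 ≤ p) (hp : p ≠ ⊤) :
    IsNormPowGradient p.toReal (pLaplaceN : W1p D p → W1p D p → ℝ) := by
  have h1 := isNormPowGradient_lpDuality (E := ℝ) (μ := volume.restrict D) hp2 hp
  have h2 := isNormPowGradient_lpDuality (E := Euc d) (μ := volume.restrict D) hp2 hp
  refine ⟨h1.two_le, fun u v => ?_, fun u w c => ?_, fun u w => ?_, fun u w => ?_⟩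
  · simp only [W1p_norm_rpow hp]
    have e1 := h1.clarkson u.1.fst v.1.fst
    have e2 := h2.clarkson u.1.snd v.1.snd
    simp only [Submodule.coe_smul, Submodule.coe_add, Submodule.coe_sub, WithLp.smul_fst,
      WithLp.smul_snd, WithLp.add_fst, WithLp.add_snd, WithLp.sub_fst, WithLp.sub_snd]
    linarith
  · simp only [pLaplaceN_eq_add hp2 hp, Submodule.coe_smul, WithLp.smul_fst, WithLp.smul_snd,
      h1.smul_right, h2.smul_right]
    ring
  · simp only [pLaplaceN_eq_add hp2 hp, W1p_norm_rpow hp, Submodule.coe_sub, WithLp.sub_fst,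
      WithLp.sub_snd]
    linarith [h1.gradient u.1.fst w.1.fst, h2.gradient u.1.snd w.1.snd]
  · simp only [pLaplaceN_eq_add hp2 hp, Submodule.coe_smul, Submodule.coe_add, WithLp.smul_fst,
      WithLp.smul_snd, WithLp.add_fst, WithLp.add_snd]
    exact (h1.hemicontinuous _ _).add (h2.hemicontinuous _ _)

/-- The continuous inclusion `W^{1,p}(D) ⊆ L²(D)`, `p ≥ 2`, for `D` of finite measure. -/
noncomputable def W1p.toL2 [IsFiniteMeasure (volume.restrict D)] (hp2 : 2 ≤ p) :
    W1p D p →L[ℝ] L2 D :=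
  (lpInclusion (volume.restrict D) hp2) ∘L
    (WithLp.fstL p ℝ (Lp ℝ p (volume.restrict D)) (Lp (Euc d) p (volume.restrict D))) ∘L
    (W1p D p).subtypeL

lemma W1p.coeFn_toL2 [IsFiniteMeasure (volume.restrict D)] (hp2 : 2 ≤ p) (u : W1p D p) :
    W1p.toL2 hp2 u =ᵐ[volume.restrict D] W1p.toFn u :=
  coeFn_lpInclusion hp2 u.1.fst

end Sobolev

/-! ### The deterministic step equation -/

/-- `ψ_ε` is nondecreasing with slope at most `1 / ε`. -/
lemma psiMY_sub_mem {ε : ℝ} (hε : 0 < ε) {x y : ℝ} (hxy : x ≤ y) :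
    0 ≤ psiMY ε y - psiMY ε x ∧ psiMY ε y - psiMY ε x ≤ (y - x) / ε := by
  have e : psiMY ε y - psiMY ε x
      = ((max (-x) 0 - max (-y) 0) + (max (y - 1) 0 - max (x - 1) 0)) / ε := by
    simp only [psiMY]; ring
  rw [e]
  refine ⟨div_nonneg ?_ hε.le, div_le_div_of_nonneg_right ?_ hε.le⟩ <;>
  · rcases max_cases (-x) 0 with h1 | h1 <;> rcases max_cases (-y) 0 with h2 | h2 <;>
      rcases max_cases (x - 1) 0 with h3 | h3 <;> rcases max_cases (y - 1) 0 with h4 | h4 <;>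
      linarith [h1.1, h1.2, h2.1, h2.2, h3.1, h3.2, h4.1, h4.2]

/-- The zeroth-order part `x + τ ψ_ε(x) - τ β(x)` of the step equation, minus `κ x`. -/
noncomputable def stepPerturbation (ε τ κ : ℝ) (β : ℝ → ℝ) (x : ℝ) : ℝ :=
  x + τ * psiMY ε x - τ * β x - κ * x

lemma stepPerturbation_zero (ε τ κ : ℝ) {β : ℝ → ℝ} (hβ0 : β 0 = 0) :
    stepPerturbation ε τ κ β 0 = 0 := by
  simp [stepPerturbation, psiMY, hβ0]

/-- The slopes of `x + τ ψ_ε(x) - τ β(x)` lie between `1 - τ L` and `κ = 1 + τ / ε + τ L`; after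
subtracting `κ x` they are negative, and bounded by `κ - (1 - τ L)` in absolute value. -/
lemma abs_stepPerturbation_sub_le {ε τ L : ℝ} (hε : 0 < ε) (hτ : 0 ≤ τ) {β : ℝ → ℝ}
    (hβ : ∀ r s, |β r - β s| ≤ L * |r - s|) (x y : ℝ) :
    |stepPerturbation ε τ (1 + τ / ε + τ * L) β x - stepPerturbation ε τ (1 + τ / ε + τ * L) β y|
      ≤ (τ / ε + 2 * (τ * L)) * |x - y| := by
  wlog hxy : x ≤ y generalizing x y
  · rw [abs_sub_comm, abs_sub_comm x]; exact this y x (le_of_not_ge hxy)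
  obtain ⟨h1, h2⟩ := psiMY_sub_mem hε hxy
  have h3 := abs_le.1 (hβ y x)
  rw [abs_sub_comm, abs_sub_comm x, abs_of_nonneg (sub_nonneg.2 hxy)]
  rw [abs_of_nonneg (sub_nonneg.2 hxy)] at h3
  have h4 := mul_le_mul_of_nonneg_left h1 hτ
  have h5 := mul_le_mul_of_nonneg_left h2 hτ
  have h6 := mul_le_mul_of_nonneg_left h3.1 hτ
  have h7 := mul_le_mul_of_nonneg_left h3.2 hτ
  have e5 : τ * ((y - x) / ε) = τ / ε * (y - x) := by ring
  rw [e5] at h5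
  simp only [stepPerturbation]
  rw [abs_le]
  constructor <;> nlinarith

section Step

variable {d : ℕ} {D : Set (Euc d)} {p : ℝ≥0∞} [Fact (1 ≤ p)]
  [IsFiniteMeasure (volume.restrict D)]

omit [IsFiniteMeasure (volume.restrict D)] in
lemma coeFn_add_add_smul (τ : ℝ) (a N F : L2 D) :
    (a + N + τ • F : L2 D) =ᵐ[volume.restrict D] fun x => a x + N x + τ * F x := by
  filter_upwards [Lp.coeFn_add (a + N) (τ • F), Lp.coeFn_add a N, Lp.coeFn_smul τ F]
    with x h6 h7 h8
  rw [h6, Pi.add_apply, h7, Pi.add_apply, h8, Pi.smul_apply, smul_eq_mul]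

lemma integral_mul_toFn (hp2 : 2 ≤ p) (h : L2 D) (w : W1p D p) :
    ∫ x in D, h x * W1p.toFn w x = ⟪h, W1p.toL2 hp2 w⟫_ℝ := by
  rw [L2.inner_def]
  refine integral_congr_ae ?_
  filter_upwards [W1p.coeFn_toL2 hp2 w] with x hx
  rw [hx, RCLike.inner_apply, conj_trivial, mul_comm]

set_option maxHeartbeats 800000 in
/-- The step equation in weak form: pairing with all `w` in `W^{1,p}(D)` determines which element
of `L²(D)` represents the `p`-Laplacian. -/
lemma stepEquation_iff (hp2 : 2 ≤ p) {ε τ κ : ℝ} (hτ : 0 < τ) {β : ℝ → ℝ}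
    {a N F b z q : L2 D} {u : W1p D p} (hz : z =ᵐ[volume.restrict D] W1p.toFn u)
    (hq : q =ᵐ[volume.restrict D] stepPerturbation ε τ κ β ∘ z)
    (hb : b =ᵐ[volume.restrict D] fun x => a x + N x + τ * F x) :
    StepEquation ε τ β a N F u ↔ ∀ w : W1p D p,
      τ * pLaplaceN u w + κ * ⟪z, W1p.toL2 hp2 w⟫_ℝ + ⟪q, W1p.toL2 hp2 w⟫_ℝ
        = ⟪b, W1p.toL2 hp2 w⟫_ℝ := by
  obtain ⟨h₀, hh₀⟩ : ∃ h₀ : L2 D, τ • h₀ = b - κ • z - q :=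
    ⟨τ⁻¹ • (b - κ • z - q), by rw [smul_smul, mul_inv_cancel₀ hτ.ne', one_smul]⟩
  have hval : ∀ᵐ x ∂(volume.restrict D), τ * h₀ x = a x + N x + τ * F x
      - (W1p.toFn u x + τ * psiMY ε (W1p.toFn u x) - τ * β (W1p.toFn u x)) := by
    filter_upwards [Lp.coeFn_smul τ h₀, Lp.coeFn_sub (b - κ • z) q, Lp.coeFn_sub b (κ • z),
      Lp.coeFn_smul κ z, hq, hb, hz] with x h1 h2 h3 h4 h5 h6 h7
    rw [Pi.smul_apply, smul_eq_mul] at h1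
    rw [← h1, hh₀, h2, Pi.sub_apply, h3, Pi.sub_apply, h4, Pi.smul_apply, h5,
      Function.comp_apply, h6, h7]
    simp only [stepPerturbation, smul_eq_mul]
    ring
  have hinner : ∀ w : L2 D, τ * ⟪h₀, w⟫_ℝ = ⟪b, w⟫_ℝ - κ * ⟪z, w⟫_ℝ - ⟪q, w⟫_ℝ := fun w => by
    rw [← real_inner_smul_left, hh₀, inner_sub_left, inner_sub_left, real_inner_smul_left]
  constructor
  · rintro ⟨h, hh, heq⟩ w
    have e : h = h₀ := by
      refine Lp.ext ?_
      filter_upwards [heq, hval] with x h1 h2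
      have : τ * h x = τ * h₀ x := by rw [h2]; linarith
      exact mul_left_cancel₀ hτ.ne' this
    subst e
    have h1 : pLaplaceN u w = ⟪h, W1p.toL2 hp2 w⟫_ℝ := (hh w).trans (integral_mul_toFn hp2 h w)
    generalize W1p.toL2 hp2 w = y at h1 ⊢
    rw [h1]
    linarith [hinner y]
  · intro hw
    refine ⟨h₀, fun w => ?_, ?_⟩
    · refine Eq.trans (mul_left_cancel₀ hτ.ne' ?_) (integral_mul_toFn hp2 h₀ w).symm
      have h1 := hw w
      generalize W1p.toL2 hp2 w = y at h1 ⊢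
      linarith [hinner y]
    · filter_upwards [hval] with x h1
      rw [mul_add, h1]; ring

/-- The step equation has a unique solution, which depends continuously on the data. -/
lemma exists_continuous_stepEquation_iff (hp2 : 2 ≤ p) (hp : p ≠ ⊤) {ε τ L : ℝ} (hε : 0 < ε)
    (hτ : 0 < τ) (hL : 0 < L) (hτL : τ < 1 / L) {β : ℝ → ℝ}
    (hβ : ∀ r s, |β r - β s| ≤ L * |r - s|) (hβ0 : β 0 = 0) :
    ∃ s : L2 D → W1p D p, Continuous s ∧ ∀ (a N F : L2 D) (u : W1p D p),
      StepEquation ε τ β a N F u ↔ u = s (a + N + τ • F) := by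
  have : CompleteSpace (W1p D p) := (isClosed_W1p (D := D) (p := p)).completeSpace_coe
  have hA := isNormPowGradient_pLaplaceN (D := D) hp2 hp
  have hτL1 : τ * L < 1 := by rwa [lt_div_iff₀ hL] at hτL
  let K : ℝ≥0 := ⟨τ / ε + 2 * (τ * L), by positivity⟩
  have hk : LipschitzWith K (stepPerturbation ε τ (1 + τ / ε + τ * L) β) :=
    LipschitzWith.of_dist_le_mul fun x y => abs_stepPerturbation_sub_le hε hτ.le hβ x y
  have hk0 := stepPerturbation_zero ε τ (1 + τ / ε + τ * L) hβ0
  have hKκ : (K : ℝ) < 1 + τ / ε + τ * L := by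
    show τ / ε + 2 * (τ * L) < _
    linarith
  have hkL := LipschitzWith.lipschitzWith_compLp (p := 2) (μ := volume.restrict D) hk hk0
  choose s hs using hA.exists_solution (W1p.toL2 hp2) hτ hkL hKκ
  refine ⟨s, hA.continuous_solution (W1p.toL2 hp2) hτ hkL hKκ hs, fun a N F u => ?_⟩
  rw [stepEquation_iff hp2 hτ (W1p.coeFn_toL2 hp2 u) (hk.coeFn_compLp hk0 (W1p.toL2 hp2 u))
    (coeFn_add_add_smul τ a N F)]
  exact ⟨fun h => hA.solution_unique (W1p.toL2 hp2) hτ hkL hKκ h (hs _), fun h => h ▸ hs _⟩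

end Step

/-! ### Increments of independent Wiener processes -/

section Wiener

variable {Ω : Type*} {mΩ : MeasurableSpace Ω} {P : Measure Ω}
  {𝓕 : Filtration ℝ≥0 mΩ}

namespace IsWienerProcess

variable {B B' : ℝ≥0 → Ω → ℝ} {s t : ℝ≥0}

lemma stronglyMeasurable_sub (hB : IsWienerProcess P 𝓕 B) (hst : s ≤ t) :
    StronglyMeasurable[𝓕 t] fun ω => B t ω - B s ω :=
  (hB.adapted t).sub ((hB.adapted s).mono (𝓕.mono hst))

lemma hasLaw_sub (hB : IsWienerProcess P 𝓕 B) (s t : ℝ≥0) :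
    HasLaw (fun ω => B t ω - B s ω) (gaussianReal 0 (nndist t.1 s.1)) P :=
  hB.brownian.toIsPreBrownianReal.hasLaw_sub t s

lemma memLp_sub (hB : IsWienerProcess P 𝓕 B) (s t : ℝ≥0) :
    MemLp (fun ω => B t ω - B s ω) 2 P := by
  have h1 := hB.hasLaw_sub s t
  have h2 : HasLaw (id : ℝ → ℝ) (gaussianReal 0 (nndist t.1 s.1))
      (gaussianReal 0 (nndist t.1 s.1)) := HasLaw.id
  exact (h1.identDistrib h2).memLp_iff.2 (by exact_mod_cast memLp_id_gaussianReal 2)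

lemma integral_sub (hB : IsWienerProcess P 𝓕 B) (s t : ℝ≥0) :
    ∫ ω, (B t ω - B s ω) ∂P = 0 := by
  have := (hB.hasLaw_sub s t).integral_eq
  rwa [integral_id_gaussianReal] at this

lemma integral_sub_sq (hB : IsWienerProcess P 𝓕 B) (hst : s ≤ t) :
    ∫ ω, (B t ω - B s ω) ^ 2 ∂P = t - s := by
  have h1 := (hB.hasLaw_sub s t).variance_eq
  rw [variance_id_gaussianReal, variance_of_integral_eq_zero (hB.hasLaw_sub s t).aemeasurable
    (hB.integral_sub s t)] at h1
  rw [h1, coe_nndist, Real.dist_eq]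
  exact abs_of_nonneg (sub_nonneg.2 hst)

lemma indepFun_sub (hB : IsWienerProcess P 𝓕 B) (hst : s ≤ t) {X : Ω → ℝ}
    (hX : StronglyMeasurable[𝓕 s] X) : IndepFun X (fun ω => B t ω - B s ω) P := by
  rw [IndepFun_iff_Indep]
  exact (indep_of_indep_of_le_right (hB.indep s t hst) hX.measurable.comap_le).symm

lemma integral_mul_sub (hB : IsWienerProcess P 𝓕 B) (hst : s ≤ t) {X : Ω → ℝ}
    (hX : StronglyMeasurable[𝓕 s] X) : ∫ ω, X ω * (B t ω - B s ω) ∂P = 0 := by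
  rw [(hB.indepFun_sub hst hX).integral_fun_mul_eq_mul_integral
    (hX.mono (𝓕.le s)).aestronglyMeasurable (hB.memLp_sub s t).aestronglyMeasurable,
    hB.integral_sub, mul_zero]

lemma integral_mul_sub_sq (hB : IsWienerProcess P 𝓕 B) (hst : s ≤ t) {X : Ω → ℝ}
    (hX : StronglyMeasurable[𝓕 s] X) :
    ∫ ω, X ω * (B t ω - B s ω) ^ 2 ∂P = (∫ ω, X ω ∂P) * (t - s) := by
  have hi : IndepFun X (fun ω => (B t ω - B s ω) ^ 2) P :=
    (hB.indepFun_sub hst hX).comp measurable_id (measurable_id.pow_const 2)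
  rw [hi.integral_fun_mul_eq_mul_integral (hX.mono (𝓕.le s)).aestronglyMeasurable
    ((hB.memLp_sub s t).aestronglyMeasurable.pow 2), hB.integral_sub_sq hst]

lemma integrable_sub_mul_sub (hB : IsWienerProcess P 𝓕 B) (hB' : IsWienerProcess P 𝓕 B')
    (s t s' t' : ℝ≥0) : Integrable (fun ω => (B t ω - B s ω) * (B' t' ω - B' s' ω)) P :=
  (hB.memLp_sub s t).integrable_mul (hB'.memLp_sub s' t')

/-- Increments of two (possibly equal) Wiener processes over disjoint intervals are orthogonal,
also with a weight that is measurable at the start. -/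
lemma integral_sub_mul_sub_mul_of_le (hB : IsWienerProcess P 𝓕 B)
    (hB' : IsWienerProcess P 𝓕 B') {a s' t' : ℝ≥0} (has : a ≤ s) (hst : s ≤ t) (hts : t ≤ s')
    (hst' : s' ≤ t') {X : Ω → ℝ} (hX : StronglyMeasurable[𝓕 a] X) :
    ∫ ω, (B t ω - B s ω) * (B' t' ω - B' s' ω) * X ω ∂P = 0 := by
  have h1 : StronglyMeasurable[𝓕 s'] fun ω => X ω * (B t ω - B s ω) :=
    (hX.mono (𝓕.mono (has.trans (hst.trans hts)))).mul
      ((hB.stronglyMeasurable_sub hst).mono (𝓕.mono hts))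
  rw [← hB'.integral_mul_sub hst' h1]
  refine integral_congr_ae (Eventually.of_forall fun ω => ?_)
  show _ * _ * _ = _ * _ * _
  ring

lemma integral_sub_mul_sub_grid (hB : IsWienerProcess P 𝓕 B) {t : ℕ → ℝ≥0} (ht : Monotone t)
    {h : ℝ≥0} (hh : ∀ i, (t (i + 1) : ℝ) - t i = h) (i l : ℕ) :
    ∫ ω, (B (t (i + 1)) ω - B (t i) ω) * (B (t (l + 1)) ω - B (t l) ω) ∂P
      = if i = l then (h : ℝ) else 0 := by
  have hoff : ∀ i l, i < l →
      ∫ ω, (B (t (i + 1)) ω - B (t i) ω) * (B (t (l + 1)) ω - B (t l) ω) ∂P = 0 :=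
    fun i l hil => hB.integral_mul_sub (ht l.le_succ)
      ((hB.stronglyMeasurable_sub (ht i.le_succ)).mono (𝓕.mono (ht hil)))
  rcases lt_trichotomy i l with hil | rfl | hil
  · rw [if_neg hil.ne, hoff i l hil]
  · rw [if_pos rfl, ← hh i, ← hB.integral_sub_sq (ht i.le_succ)]
    simp only [sq]
  · rw [if_neg hil.ne', ← hoff l i hil]
    simp only [mul_comm]

/-- Increments of independent Wiener processes are conditionally orthogonal given the past. Each
process being Wiener for `𝓕` and the processes being independent does not directly say that the
pair of increments is independent of the past. On a grid of mesh `h`, however, the off-diagonal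
products of increments are orthogonal to the past, and the diagonal ones sum up to a variable of
variance `(b - a) h`. -/
lemma integral_sub_mul_sub_mul_of_indepFun [IsProbabilityMeasure P]
    (hB : IsWienerProcess P 𝓕 B) (hB' : IsWienerProcess P 𝓕 B')
    (hind : IndepFun (fun ω t => B t ω) (fun ω t => B' t ω) P)
    {a b : ℝ≥0} (hab : a ≤ b) {X : Ω → ℝ} (hX : StronglyMeasurable[𝓕 a] X) {C : ℝ}
    (hC : ∀ ω, |X ω| ≤ C) :
    ∫ ω, (B b ω - B a ω) * (B' b ω - B' a ω) * X ω ∂P = 0 := by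
  have hXm : AEStronglyMeasurable X P := (hX.mono (𝓕.le a)).aestronglyMeasurable
  have hbound : ∀ n : ℕ, |∫ ω, (B b ω - B a ω) * (B' b ω - B' a ω) * X ω ∂P|
      ≤ (((b : ℝ) - a) ^ 2 + C ^ 2) / 2 * (1 / ((n : ℝ) + 1)) := by
    intro n
    set m : ℕ := (n + 1) ^ 2 with hm
    set h : ℝ≥0 := (b - a) / m with hh
    set t : ℕ → ℝ≥0 := fun i => a + i * h with ht
    have hm0 : (m : ℝ≥0) ≠ 0 := by rw [hm]; positivity
    have ht0 : t 0 = a := by simp [ht]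
    have htm : t m = b := by
      simp only [ht, hh]
      rw [mul_div_cancel₀ _ hm0, add_tsub_cancel_of_le hab]
    have htmono : Monotone t := fun i l hil => by
      simp only [ht]; gcongr
    have hat : ∀ i, a ≤ t i := fun i => le_self_add
    have hdt : ∀ i, ((t (i + 1) : ℝ≥0) : ℝ) - t i = h := fun i => by
      simp only [ht]; push_cast; ring
    have hmh : (m : ℝ) * ((h : ℝ) * h) = ((b : ℝ) - a) ^ 2 / ((n : ℝ) + 1) ^ 2 := by
      have : (h : ℝ) = ((b : ℝ) - a) / ((n : ℝ) + 1) ^ 2 := by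
        rw [hh, hm, NNReal.coe_div, NNReal.coe_sub hab]; push_cast; rfl
      rw [this, hm]; push_cast; field_simp
    let x : ℕ → Ω → ℝ := fun i ω => B (t (i + 1)) ω - B (t i) ω
    let y : ℕ → Ω → ℝ := fun i ω => B' (t (i + 1)) ω - B' (t i) ω
    have hxsum : ∀ ω, ∑ i ∈ Finset.range m, x i ω = B b ω - B a ω := fun ω => by
      have := Finset.sum_range_sub (fun i => B (t i) ω) m
      simpa only [htm, ht0] using this
    have hysum : ∀ ω, ∑ i ∈ Finset.range m, y i ω = B' b ω - B' a ω := fun ω => by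
      have := Finset.sum_range_sub (fun i => B' (t i) ω) m
      simpa only [htm, ht0] using this
    have hint : ∀ i l, Integrable (fun ω => x i ω * y l ω * X ω) P := fun i l =>
      (hB.integrable_sub_mul_sub hB' _ _ _ _).mul_bdd hXm (Eventually.of_forall hC)
    have hoff : ∀ i l, i ≠ l → ∫ ω, x i ω * y l ω * X ω ∂P = 0 := by
      intro i l hil
      rcases lt_or_gt_of_ne hil with h1 | h1
      · exact hB.integral_sub_mul_sub_mul_of_le hB' (hat i) (htmono i.le_succ) (htmono h1)
          (htmono l.le_succ) hX
      · rw [← hB'.integral_sub_mul_sub_mul_of_le hB (hat l) (htmono l.le_succ) (htmono h1)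
          (htmono i.le_succ) hX]
        exact integral_congr_ae (Eventually.of_forall fun ω => by
          show x i ω * y l ω * X ω = y l ω * x i ω * X ω
          ring)
    let R : Ω → ℝ := fun ω => ∑ i ∈ Finset.range m, x i ω * y i ω
    have hdiag : ∫ ω, (B b ω - B a ω) * (B' b ω - B' a ω) * X ω ∂P = ∫ ω, R ω * X ω ∂P := by
      have e1 : ∀ ω, (B b ω - B a ω) * (B' b ω - B' a ω) * X ω
          = ∑ i ∈ Finset.range m, ∑ l ∈ Finset.range m, x i ω * y l ω * X ω := fun ω => by
        rw [← hxsum, ← hysum, Finset.sum_mul_sum, Finset.sum_mul]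
        exact Finset.sum_congr rfl fun i _ => Finset.sum_mul _ _ _
      have e2 : ∀ ω, R ω * X ω = ∑ i ∈ Finset.range m, x i ω * y i ω * X ω := fun ω =>
        Finset.sum_mul _ _ _
      simp only [e1, e2]
      rw [integral_finsetSum _ fun i _ => integrable_finsetSum _ fun l _ => hint i l,
        integral_finsetSum _ fun i _ => hint i i]
      refine Finset.sum_congr rfl fun i hi => ?_
      rw [integral_finsetSum _ fun l _ => hint i l]
      exact Finset.sum_eq_single_of_mem i hi fun l _ hl => hoff i l hl.symm
    -- The diagonal sum has second moment `m h²`.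
    have hxx : ∀ i l, ∫ ω, x i ω * x l ω ∂P = if i = l then (h : ℝ) else 0 :=
      hB.integral_sub_mul_sub_grid htmono hdt
    have hyy : ∀ i l, ∫ ω, y i ω * y l ω ∂P = if i = l then (h : ℝ) else 0 :=
      hB'.integral_sub_mul_sub_grid htmono hdt
    have hindxy : ∀ i l, IndepFun (fun ω => x i ω * x l ω) (fun ω => y i ω * y l ω) P := by
      intro i l
      let Φ : (ℝ≥0 → ℝ) → ℝ := fun w =>
        (w (t (i + 1)) - w (t i)) * (w (t (l + 1)) - w (t l))
      have hΦ : Measurable Φ := by fun_prop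
      exact hind.comp hΦ hΦ
    have hint4 : ∀ i l, Integrable (fun ω => (x i ω * x l ω) * (y i ω * y l ω)) P := fun i l =>
      (hindxy i l).integrable_mul (hB.integrable_sub_mul_sub hB _ _ _ _)
        (hB'.integrable_sub_mul_sub hB' _ _ _ _)
    have e3 : ∀ ω, R ω ^ 2 = ∑ i ∈ Finset.range m, ∑ l ∈ Finset.range m,
        (x i ω * x l ω) * (y i ω * y l ω) := fun ω => by
      rw [sq, Finset.sum_mul_sum]
      exact Finset.sum_congr rfl fun i _ => Finset.sum_congr rfl fun l _ => by ring
    have hR2int : Integrable (fun ω => R ω ^ 2) P := by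
      simp only [e3]
      exact integrable_finsetSum _ fun i _ => integrable_finsetSum _ fun l _ => hint4 i l
    have hR2 : ∫ ω, R ω ^ 2 ∂P = m * ((h : ℝ) * h) := by
      simp only [e3]
      rw [integral_finsetSum _ fun i _ => integrable_finsetSum _ fun l _ => hint4 i l]
      have : ∀ i ∈ Finset.range m, ∫ ω, ∑ l ∈ Finset.range m,
          (x i ω * x l ω) * (y i ω * y l ω) ∂P = (h : ℝ) * h := by
        intro i hi
        rw [integral_finsetSum _ fun l _ => hint4 i l]
        have e4 : ∀ l, ∫ ω, (x i ω * x l ω) * (y i ω * y l ω) ∂P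
            = if i = l then (h : ℝ) * h else 0 := fun l => by
          rw [(hindxy i l).integral_fun_mul_eq_mul_integral
            (hB.integrable_sub_mul_sub hB _ _ _ _).aestronglyMeasurable
            (hB'.integrable_sub_mul_sub hB' _ _ _ _).aestronglyMeasurable, hxx, hyy]
          split_ifs <;> simp
        simp only [e4]
        rw [Finset.sum_ite_eq, if_pos hi]
      rw [Finset.sum_congr rfl this, Finset.sum_const, Finset.card_range, nsmul_eq_mul]
    -- `|R X| ≤ ((n + 1) R² + C² / (n + 1)) / 2`; the number of grid points is `(n + 1)²`.
    rw [hdiag]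
    have hn : (0 : ℝ) < (n : ℝ) + 1 := by positivity
    calc |∫ ω, R ω * X ω ∂P|
        ≤ ∫ ω, (((n : ℝ) + 1) * R ω ^ 2 + C ^ 2 / ((n : ℝ) + 1)) / 2 ∂P := by
          rw [← Real.norm_eq_abs]
          refine norm_integral_le_of_norm_le (μ := P)
            (((hR2int.const_mul _).add (integrable_const _)).div_const 2)
            (Eventually.of_forall fun ω => ?_)
          rw [Real.norm_eq_abs, abs_mul]
          have h1 : |R ω| * |X ω| ≤ |R ω| * C := mul_le_mul_of_nonneg_left (hC ω) (abs_nonneg _)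
          have h2 : 0 ≤ (((n : ℝ) + 1) * |R ω| - C) ^ 2 / ((n : ℝ) + 1) := by positivity
          have h3 : (((n : ℝ) + 1) * |R ω| - C) ^ 2 / ((n : ℝ) + 1)
              = ((n : ℝ) + 1) * R ω ^ 2 + C ^ 2 / ((n : ℝ) + 1) - 2 * (|R ω| * C) := by
            rw [← sq_abs (R ω)]; field_simp; ring
          linarith
      _ = (((n : ℝ) + 1) * (m * ((h : ℝ) * h)) + C ^ 2 / ((n : ℝ) + 1)) / 2 := by
          rw [integral_div, integral_add (hR2int.const_mul _) (integrable_const _),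
            integral_const_mul, hR2]
          simp
      _ = _ := by
          rw [hmh]; field_simp
  have hlim : Tendsto (fun n : ℕ => (((b : ℝ) - a) ^ 2 + C ^ 2) / 2 * (1 / ((n : ℝ) + 1)))
      atTop (𝓝 0) := by
    simpa using (tendsto_one_div_add_atTop_nhds_zero_nat (𝕜 := ℝ)).const_mul
      ((((b : ℝ) - a) ^ 2 + C ^ 2) / 2)
  exact abs_eq_zero.1 (le_antisymm (ge_of_tendsto' hlim hbound) (abs_nonneg _))

end IsWienerProcess

end Wiener

/-! ### The noise increment -/

/-- Pairwise orthogonal vectors with square-summable norms form a summable family. -/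
lemma summable_of_pairwise_inner_eq_zero {ι H : Type*} [NormedAddCommGroup H]
    [InnerProductSpace ℝ H] [CompleteSpace H] {x : ι → H}
    (hx : Pairwise fun i j => ⟪x i, x j⟫_ℝ = 0) (hs : Summable fun i => ‖x i‖ ^ 2) :
    Summable x := by
  have hV : OrthogonalFamily ℝ (fun i => ↥(Submodule.span ℝ {x i}))
      fun i => (Submodule.span ℝ {x i}).subtypeₗᵢ := by
    refine OrthogonalFamily.of_pairwise fun i j hij => ?_
    refine Submodule.isOrtho_span.2 ?_
    rintro _ rfl _ rfl
    exact hx hij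
  exact (hV.summable_iff_norm_sq_summable fun i =>
    ⟨x i, Submodule.mem_span_singleton_self (x i)⟩).2 hs

section NoiseSeries

variable {Ω : Type*} {mΩ : MeasurableSpace Ω} {P : Measure Ω} [IsProbabilityMeasure P]
  {𝓕 : Filtration ℝ≥0 mΩ} {K : Type*} [NormedAddCommGroup K] [InnerProductSpace ℝ K]
  [CompleteSpace K]

/-- The terms of the series are orthogonal in `L²(Ω; K)`, and by independence the squared norm of
the `j`-th one is `(b - a) E‖Z_j‖²`. -/
lemma exists_stronglyMeasurable_noiseSeries {W : ℕ → ℝ≥0 → Ω → ℝ}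
    (hW : ∀ j, IsWienerProcess P 𝓕 (W j)) (hind : iIndepFun (fun j ω t => W j t ω) P)
    {a b : ℝ≥0} (hab : a ≤ b) {Z : ℕ → Ω → K} (hZ : ∀ j, StronglyMeasurable[𝓕 a] (Z j)) {C : ℝ}
    (hC : ∀ (s : Finset ℕ) (ω : Ω), ∑ j ∈ s, ‖Z j ω‖ ^ 2 ≤ C) :
    ∃ N : Ω → K, StronglyMeasurable[𝓕 b] N ∧ MemLp N 2 P ∧
      Tendsto (fun k : ℕ => eLpNorm
        (fun ω => ∑ j ∈ Finset.range k, (W j b ω - W j a ω) • Z j ω - N ω) 2 P) atTop (𝓝 0) := by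
  have hZC : ∀ j ω, ‖Z j ω‖ ^ 2 ≤ C := fun j ω => by simpa using hC {j} ω
  have hZC' : ∀ j ω, ‖Z j ω‖ ≤ √C := fun j ω => Real.le_sqrt_of_sq_le (hZC j ω)
  have hXm : ∀ j, StronglyMeasurable[𝓕 b] fun ω => (W j b ω - W j a ω) • Z j ω := fun j =>
    ((hW j).stronglyMeasurable_sub hab).smul ((hZ j).mono (𝓕.mono hab))
  have hX : ∀ j, MemLp (fun ω => (W j b ω - W j a ω) • Z j ω) 2 P := fun j => by
    refine ((hW j).memLp_sub a b).of_le_mul (c := √C)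
      ((hXm j).mono (𝓕.le b)).aestronglyMeasurable (Eventually.of_forall fun ω => ?_)
    rw [norm_smul, mul_comm]
    exact mul_le_mul_of_nonneg_right (hZC' j ω) (norm_nonneg _)
  let x : ℕ → Lp K 2 P := fun j => (hX j).toLp _
  have hinner : ∀ i j, ⟪x i, x j⟫_ℝ
      = ∫ ω, (W i b ω - W i a ω) * (W j b ω - W j a ω) * ⟪Z i ω, Z j ω⟫_ℝ ∂P := fun i j => by
    rw [L2.inner_def]
    refine integral_congr_ae ?_
    filter_upwards [(hX i).coeFn_toLp, (hX j).coeFn_toLp] with ω h1 h2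
    rw [h1, h2, real_inner_smul_left, real_inner_smul_right]
    ring
  have hZZ : ∀ i j, StronglyMeasurable[𝓕 a] fun ω => ⟪Z i ω, Z j ω⟫_ℝ := fun i j =>
    (hZ i).inner (hZ j)
  have horth : Pairwise fun i j => ⟪x i, x j⟫_ℝ = 0 := fun i j hij => by
    show ⟪x i, x j⟫_ℝ = 0
    rw [hinner]
    refine (hW i).integral_sub_mul_sub_mul_of_indepFun (hW j) (hind.indepFun hij) hab
      (hZZ i j) (C := √C * √C) fun ω => ?_
    exact (abs_real_inner_le_norm _ _).trans
      (mul_le_mul (hZC' i ω) (hZC' j ω) (norm_nonneg _) (Real.sqrt_nonneg _))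
  have hnorm : ∀ j, ‖x j‖ ^ 2 = (∫ ω, ‖Z j ω‖ ^ 2 ∂P) * (b - a) := fun j => by
    have hm : StronglyMeasurable[𝓕 a] fun ω => ‖Z j ω‖ ^ 2 := (hZ j).norm.pow 2
    rw [← real_inner_self_eq_norm_sq, hinner, ← (hW j).integral_mul_sub_sq hab hm]
    refine integral_congr_ae (Eventually.of_forall fun ω => ?_)
    show _ * _ * ⟪Z j ω, Z j ω⟫_ℝ = ‖Z j ω‖ ^ 2 * _ ^ 2
    rw [real_inner_self_eq_norm_sq]; ring
  have hsq : ∀ j, Integrable (fun ω => ‖Z j ω‖ ^ 2) P := fun j =>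
    Integrable.of_bound ((((hZ j).mono (𝓕.le a)).norm.pow 2).aestronglyMeasurable) C
      (Eventually.of_forall fun ω => by
        rw [Real.norm_of_nonneg (by positivity)]; exact hZC j ω)
  have hsum : Summable fun j => ‖x j‖ ^ 2 := by
    simp only [hnorm]
    refine Summable.mul_right _ (summable_of_sum_le (c := C)
      (fun j => integral_nonneg fun ω => by positivity) fun s => ?_)
    rw [← integral_finsetSum _ fun j _ => hsq j]
    calc ∫ ω, ∑ j ∈ s, ‖Z j ω‖ ^ 2 ∂P ≤ ∫ _, C ∂P :=
          integral_mono (integrable_finsetSum _ fun j _ => hsq j) (integrable_const _)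
            fun ω => hC s ω
      _ = C := by simp
  have hx : Summable x := summable_of_pairwise_inner_eq_zero horth hsum
  have htend := hx.hasSum.tendsto_sum_nat
  have hpart : ∀ k : ℕ, ((∑ j ∈ Finset.range k, x j : Lp K 2 P) : Ω → K)
      =ᵐ[P] fun ω => ∑ j ∈ Finset.range k, (W j b ω - W j a ω) • Z j ω := fun k => by
    have h1 : ∀ᵐ ω ∂P, ∀ j, x j ω = (W j b ω - W j a ω) • Z j ω :=
      ae_all_iff.2 fun j => (hX j).coeFn_toLp
    filter_upwards [h1, Lp.coeFn_finsetSum (Finset.range k) x] with ω h1 h2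
    rw [h2, Finset.sum_apply]
    exact Finset.sum_congr rfl fun j _ => h1 j
  have hNm : AEStronglyMeasurable[𝓕 b] ((∑' j, x j : Lp K 2 P) : Ω → K) P :=
    (isClosed_aestronglyMeasurable (F := K) (p := 2) (μ := P) (𝓕.le b)).mem_of_tendsto htend
      (Eventually.of_forall fun k => (Finset.stronglyMeasurable_fun_sum (m := 𝓕 b) _
        fun j _ => hXm j).aestronglyMeasurable.congr (hpart k).symm)
  refine ⟨hNm.mk _, hNm.stronglyMeasurable_mk, (Lp.memLp _).ae_eq hNm.ae_eq_mk, ?_⟩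
  rw [Lp.tendsto_Lp_iff_tendsto_eLpNorm'] at htend
  refine htend.congr fun k => eLpNorm_congr_ae ?_
  filter_upwards [hpart k, hNm.ae_eq_mk] with ω h1 h2
  rw [Pi.sub_apply, h1, h2]

omit [IsProbabilityMeasure P] [CompleteSpace K] [InnerProductSpace ℝ K] in
lemma ae_eq_of_tendsto_eLpNorm_sub {X : ℕ → Ω → K} {N N' : Ω → K}
    (hX : ∀ k, AEStronglyMeasurable (X k) P) (hN : AEStronglyMeasurable N P)
    (hN' : AEStronglyMeasurable N' P)
    (h : Tendsto (fun k => eLpNorm (fun ω => X k ω - N ω) 2 P) atTop (𝓝 0))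
    (h' : Tendsto (fun k => eLpNorm (fun ω => X k ω - N' ω) 2 P) atTop (𝓝 0)) : N =ᵐ[P] N' := by
  have hle : ∀ k, eLpNorm (N - N') 2 P
      ≤ eLpNorm (fun ω => X k ω - N' ω) 2 P + eLpNorm (fun ω => X k ω - N ω) 2 P := fun k => by
    have e : N - N' = (fun ω => X k ω - N' ω) - fun ω => X k ω - N ω := by
      funext ω; simp
    rw [e]
    exact eLpNorm_sub_le ((hX k).sub hN') ((hX k).sub hN) (by norm_num)
  have h0 : eLpNorm (N - N') 2 P ≤ 0 := by
    simpa using ge_of_tendsto' (h'.add h) hle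
  have := (eLpNorm_eq_zero_iff (hN.sub hN') (by norm_num)).1 (le_antisymm h0 zero_le)
  filter_upwards [this] with ω hω
  exact sub_eq_zero.1 hω

end NoiseSeries

section Step

variable {Ω : Type*} {mΩ : MeasurableSpace Ω} {P : Measure Ω}
  {𝓕 : Filtration ℝ≥0 mΩ} {d : ℕ} {D : Set (Euc d)}

/-- Predictable processes are progressively measurable, so their time averages are adapted. -/
lemma stronglyMeasurable_timeAverage {f : ℝ≥0 → Ω → L2 D} (hf : IsStronglyPredictable 𝓕 f)
    {a b : ℝ≥0} (hab : a ≤ b) : StronglyMeasurable[𝓕 b] (timeAverage f a b) := by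
  have h1 : StronglyMeasurable[(𝓕 b).prod inferInstance] fun z : Ω × ℝ =>
      f (min z.2.toNNReal b) z.1 := by
    have hm : @Measurable (Ω × ℝ) (Set.Iic b × Ω) ((𝓕 b).prod inferInstance)
        (Subtype.instMeasurableSpace.prod (𝓕 b))
        fun z => (⟨min z.2.toNNReal b, Set.mem_Iic.2 (min_le_right _ _)⟩, z.1) := by
      refine Measurable.prodMk (Measurable.subtype_mk ?_) measurable_fst
      exact (measurable_real_toNNReal.comp measurable_snd).min measurable_const
    exact (hf.isStronglyProgressive b).comp_measurable hm
  have h2 : StronglyMeasurable[𝓕 b] fun ω =>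
      ∫ s in Set.Ioc (a : ℝ) b, f (min s.toNNReal b) ω :=
    @StronglyMeasurable.integral_prod_right' Ω ℝ (L2 D) (𝓕 b) _ _ _ _ _ _ h1
  have h3 : timeAverage f a b
      = fun ω => ((b : ℝ) - a)⁻¹ • ∫ s in Set.Ioc (a : ℝ) b, f (min s.toNNReal b) ω := by
    funext ω
    rw [timeAverage, intervalIntegral.integral_of_le (NNReal.coe_le_coe.2 hab)]
    congr 1
    refine setIntegral_congr_fun measurableSet_Ioc fun s hs => ?_
    rw [min_eq_left (Real.toNNReal_le_iff_le_coe.2 hs.2)]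
  rw [h3]
  exact h2.fun_const_smul _

/-- The hypotheses on `g_j` make the superposition operators `v ↦ g_j ∘ v` Lipschitz. -/
lemma NoiseCoefficient.lipschitzWith {U : Type*} [NormedAddCommGroup U]
    [InnerProductSpace ℝ U] [CompleteSpace U] {S : U →L[ℝ] L2 D} {e : HilbertBasis ℕ ℝ U}
    {G : L2 D → (L2 D →L[ℝ] L2 D)} {g : ℕ → ℝ → ℝ} {Lg : ℝ} (hG : NoiseCoefficient D S e G g Lg)
    (j : ℕ) : LipschitzWith (√Lg).toNNReal (g j) := by
  refine LipschitzWith.of_dist_le_mul fun r s => ?_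
  rw [Real.coe_toNNReal _ (Real.sqrt_nonneg _), Real.dist_eq, Real.dist_eq]
  refine abs_le_of_sq_le_sq' ?_ (by positivity) |>.2
  rw [mul_pow, Real.sq_sqrt hG.const_nonneg]
  exact ((hG.summable r s).le_tsum j fun _ _ => by positivity).trans (hG.lipschitz r s)

variable {U : Type*} [NormedAddCommGroup U] [InnerProductSpace ℝ U] [CompleteSpace U]
  {S : U →L[ℝ] L2 D} {e : HilbertBasis ℕ ℝ U} {G : L2 D → (L2 D →L[ℝ] L2 D)} {g : ℕ → ℝ → ℝ}
  {Lg : ℝ}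

lemma NoiseCoefficient.eq_zero (hG : NoiseCoefficient D S e G g Lg) (j : ℕ) {r : ℝ}
    (hr : r ∉ Set.Ioo (0 : ℝ) 1) : g j r = 0 :=
  image_eq_zero_of_notMem_tsupport fun h => hr (hG.support j h)

lemma NoiseCoefficient.continuous_apply (hG : NoiseCoefficient D S e G g Lg) (j : ℕ) :
    Continuous fun v => G v (S (e j)) := by
  have h0 : g j 0 = 0 := hG.eq_zero j (by simp)
  refine ((hG.lipschitzWith j).continuous_compLp (p := 2) (μ := volume.restrict D) h0).congr
    fun v => Lp.ext ?_
  filter_upwards [hG.apply_basis v j, (hG.lipschitzWith j).coeFn_compLp h0 v] with x h1 h2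
  rw [h1, h2, Function.comp_apply]

/-- As the `g_j` vanish outside of `(0, 1)`, the sum `∑_j |g_j(r)|²` is at most `L_g`. -/
lemma NoiseCoefficient.sum_norm_sq_le [IsFiniteMeasure (volume.restrict D)]
    (hG : NoiseCoefficient D S e G g Lg) (s : Finset ℕ) (v : L2 D) :
    ∑ j ∈ s, ‖G v (S (e j))‖ ^ 2 ≤ ∫ _ in D, Lg := by
  have hpt : ∀ r, ∑ j ∈ s, g j r ^ 2 ≤ Lg := fun r => by
    by_cases hr : r ∈ Set.Ioo (0 : ℝ) 1
    · have h1 := (hG.summable r 0).sum_le_tsum s fun _ _ => by positivity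
      have h2 := h1.trans (hG.lipschitz r 0)
      simp only [hG.eq_zero _ (show (0 : ℝ) ∉ Set.Ioo (0 : ℝ) 1 by simp), sub_zero, sq_abs] at h2
      refine h2.trans (mul_le_of_le_one_right hG.const_nonneg ?_)
      exact pow_le_one₀ hr.1.le hr.2.le
    · simp only [hG.eq_zero _ hr]
      simpa using hG.const_nonneg
  have hnorm : ∀ j, ‖G v (S (e j))‖ ^ 2 = ∫ x in D, (G v (S (e j)) x) ^ 2 := fun j => by
    rw [← real_inner_self_eq_norm_sq, L2.inner_def]
    refine integral_congr_ae (Eventually.of_forall fun x => ?_)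
    simp [sq]
  have hint : ∀ j, Integrable (fun x => (G v (S (e j)) x) ^ 2) (volume.restrict D) := fun j =>
    (Lp.memLp _).integrable_sq
  simp only [hnorm]
  rw [← integral_finsetSum _ fun j _ => hint j]
  refine integral_mono_ae (integrable_finsetSum _ fun j _ => hint j) (integrable_const _) ?_
  filter_upwards [ae_all_iff.2 (hG.apply_basis v)] with x hx
  simp only [hx]
  exact hpt (v x)

/-- The step problem between arbitrary times `a < b`: the continuous solution operator of the
deterministic step equation is applied to the random right-hand side. -/
lemma exists_stepSolution_unique [IsProbabilityMeasure P] [IsFiniteMeasure (volume.restrict D)]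
    {p : ℝ≥0∞} [Fact (1 ≤ p)] (hp2 : 2 ≤ p) (hp : p ≠ ⊤) (hG : NoiseCoefficient D S e G g Lg)
    {β : ℝ → ℝ} {L : ℝ} (hL : 0 < L) (hβ : ∀ r s, |β r - β s| ≤ L * |r - s|) (hβ0 : β 0 = 0)
    {f : ℝ≥0 → Ω → L2 D} (hf : IsStronglyPredictable 𝓕 f) {W : ℕ → ℝ≥0 → Ω → ℝ}
    (hW : ∀ j, IsWienerProcess P 𝓕 (W j)) (hind : iIndepFun (fun j ω t => W j t ω) P)
    {ε : ℝ} (hε : 0 < ε) {a b : ℝ≥0} (hab : a < b) (habL : (b : ℝ) - a < 1 / L)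
    {v : Ω → L2 D} (hv : StronglyMeasurable[𝓕 a] v) :
    ∃ u : Ω → W1p D p, IsStepSolution P 𝓕 S e G W β f ε a b v u ∧
      ∀ u' : Ω → W1p D p, IsStepSolution P 𝓕 S e G W β f ε a b v u' → u' =ᵐ[P] u := by
  have hZ : ∀ j, StronglyMeasurable[𝓕 a] fun ω => G (v ω) (S (e j)) := fun j =>
    (hG.continuous_apply j).comp_stronglyMeasurable hv
  obtain ⟨N, hNm, hN2, hNlim⟩ := exists_stronglyMeasurable_noiseSeries hW hind hab.le hZ
    fun s ω => hG.sum_norm_sq_le s (v ω)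
  obtain ⟨s, hs, hiff⟩ := exists_continuous_stepEquation_iff (D := D) hp2 hp hε
    (sub_pos.2 (NNReal.coe_lt_coe.2 hab)) hL habL hβ hβ0
  refine ⟨fun ω => s (v ω + N ω + ((b : ℝ) - a) • timeAverage f a b ω), ⟨?_, N, ⟨hN2, hNlim⟩,
    Eventually.of_forall fun ω => (hiff _ _ _ _).2 rfl⟩, ?_⟩
  · exact hs.comp_stronglyMeasurable (((hv.mono (𝓕.mono hab.le)).add hNm).add
      ((stronglyMeasurable_timeAverage hf hab.le).fun_const_smul _))
  · rintro u' ⟨-, N', ⟨hN2', hNlim'⟩, hu'⟩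
    have hX : ∀ k : ℕ, AEStronglyMeasurable
        (fun ω => ∑ j ∈ Finset.range k, (W j b ω - W j a ω) • G (v ω) (S (e j))) P := fun k =>
      Finset.aestronglyMeasurable_fun_sum _ fun j _ =>
        ((hW j).memLp_sub a b).aestronglyMeasurable.smul
          ((hZ j).mono (𝓕.le a)).aestronglyMeasurable
    filter_upwards [hu', ae_eq_of_tendsto_eLpNorm_sub hX hN2.aestronglyMeasurable
      hN2'.aestronglyMeasurable hNlim hNlim'] with ω h1 h2
    rw [(hiff _ _ _ _).1 h1, h2]

end Step

theorem proposition2p1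
    {Ω : Type*} {mΩ : MeasurableSpace Ω} (P : Measure Ω) [IsProbabilityMeasure P]
    (𝓕 : Filtration ℝ≥0 mΩ) (h𝓕 : UsualConditions P 𝓕)
    (T : ℝ≥0) (hT : 0 < T)
    (d : ℕ) (hd : 1 ≤ d) (D : Set (Euc d)) (hDopen : IsOpen D) (hDbdd : Bornology.IsBounded D)
    (p : ℝ≥0∞) [Fact (1 ≤ p)] (hp2 : 2 ≤ p) (hp : p ≠ ⊤)
    {U : Type*} [NormedAddCommGroup U] [InnerProductSpace ℝ U] [CompleteSpace U]
    (J : L2 D →L[ℝ] U) (Q : U →L[ℝ] U) (S : U →L[ℝ] L2 D) (e : HilbertBasis ℕ ℝ U) (lam : ℕ → ℝ)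
    (hQ : CovarianceSetting D J Q S e lam)
    -- (H1)
    (u₀ : Ω → L2 D) (hu₀_meas : StronglyMeasurable[𝓕 0] u₀) (hu₀_mem : MemLp u₀ 2 P)
    (hu₀ : ∀ᵐ ω ∂P, ∀ᵐ x ∂(volume.restrict D), 0 ≤ u₀ ω x ∧ u₀ ω x ≤ 1)
    -- (H2)
    (G : L2 D → (L2 D →L[ℝ] L2 D)) (g : ℕ → ℝ → ℝ) (Lg : ℝ) (hG : NoiseCoefficient D S e G g Lg)
    -- (H3)
    (β : ℝ → ℝ) (Lβ : ℝ) (hLβ : 0 < Lβ) (hβ : ∀ r s, |β r - β s| ≤ Lβ * |r - s|) (hβ0 : β 0 = 0)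
    -- (H4), with `f` extended outside of the time interval `(0,T)`
    (f : ℝ≥0 → Ω → L2 D) (hf_pred : IsStronglyPredictable 𝓕 f)
    (hf_mem : MemLp (fun z : ℝ × Ω => f z.1.toNNReal z.2) 2
      ((volume.restrict (Set.Ioo (0 : ℝ) T)).prod P))
    -- (H5)
    (W : ℕ → ℝ≥0 → Ω → ℝ) (calW : ℝ≥0 → Ω → U) (hW : DrivingNoise P 𝓕 D J S e W calW)
    (ε : ℝ) (hε : 0 < ε) (M : ℕ) (hM : 1 ≤ M) (τ : ℝ≥0) (hτ : τ = T / M) (hτβ : (τ : ℝ) < 1 / Lβ)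
    (n : ℕ) (hn : n < M)
    (un : Ω → L2 D) (hun : StronglyMeasurable[𝓕 (n * τ)] un) :
    ∃ u : Ω → W1p D p,
      IsStepSolution P 𝓕 S e G W β f ε (n * τ) ((n + 1) * τ) un u ∧
      ∀ u' : Ω → W1p D p,
        IsStepSolution P 𝓕 S e G W β f ε (n * τ) ((n + 1) * τ) un u' → u' =ᵐ[P] u := by
  have : IsFiniteMeasure (volume.restrict D) :=
    ⟨by simpa using hDbdd.measure_lt_top (μ := volume)⟩
  have hM0 : (0 : ℝ≥0) < M := by exact_mod_cast hM
  have hτ0 : 0 < τ := hτ ▸ div_pos hT hM0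
  have hlt : (n : ℝ≥0) * τ < (n + 1) * τ := mul_lt_mul_of_pos_right (lt_add_one _) hτ0
  have hstep : (((n + 1) * τ : ℝ≥0) : ℝ) - ((n * τ : ℝ≥0) : ℝ) = τ := by push_cast; ring
  exact exists_stepSolution_unique hp2 hp hG hLβ hβ hβ0 hf_pred hW.wiener hW.indep hε hlt
    (by rwa [hstep]) hun
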